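/- Let $D_+=\{z\in\mathbb C:|z|\le 1,\ \operatorname{Im}z\ge 0\}$, let $a>1$, let $A$ be the point $a$ of the real axis, and let $K$ be the convex hull of $D_+\cup\{A\}$. Let $t_0=\arccos(1/a)\in(0,\pi/2)$, so that $T=e^{it_0}$ is the point where the tangent line from $A$ touches $D_+$, and let $\mathcal C_A=K\setminus D_+$ be the half cap near $A$. Let $\delta>0$ and let $\phi:[0,\delta]\to\mathbb R$ satisfy $\phi(0)=\phi(\delta)=0$ and $\phi(t)>0$ for $t\in(0,\delta)$. For $\theta\in[t_0,\pi-\delta]$ put $\gamma_\theta=\{e^{it}:t\in[\theta,\theta+\delta]\}\subset\partial K$, and let $u_\theta$ be a classical solution of $$\Delta u_\theta=0\ \text{ in the interior of }K,\qquad u_\theta(e^{it})=\phi(t-\theta)\ \text{ for } t\in[\theta,\theta+\delta],\qquad u_\theta=0\ \text{ on }\partial K\setminus\gamma_\theta,$$ that is, $u_\theta$ is continuous on $K$ and harmonic in its interior (in particular $\phi$ is then continuous). Let $t_0\le\theta<\theta'\le\pi-\delta$. Then: 1. $u_\theta(z)>u_{\theta'}(z)$ for every $z$ in the interior of $\mathcal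 C_A$. 2. At every point $x\neq A$ of the segment $AT$ (with the endpoint $x=T$ included only if $\theta>t_0$), both functions have a (one-sided) outward normal derivative, where the outward unit normal is $n=T$, and $$\bigl(\partial_n u_\theta(x)\bigr)^2>\bigl(\partial_n u_{\theta'}(x)\bigr)^2 .$$ -/

import Mathlib

namespace HalfCap

/-- The closed upper half unit disk in the complex plane. -/
def upperHalfDisk : Set ℂ := {z | ‖z‖ ≤ 1 ∧ 0 ≤ z.im}

/-- The domain `K`: the convex hull of the point `a` of the real axis and of the closed upper
half unit disk. -/
def domain (a : ℝ) : Set ℂ := convexHull ℝ (insert (a : ℂ) upperHalfDisk)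

/-- The half cap near the point `a`: the part of the domain that lies outside the half disk. -/
def halfCap (a : ℝ) : Set ℂ := domain a \ upperHalfDisk

/-- The point of the unit circle with argument `t`. -/
noncomputable def circlePoint (t : ℝ) : ℂ := Complex.exp (t * Complex.I)

/-- The argument of the point at which the tangent line from `a > 1` touches the upper unit
half circle. -/
noncomputable def tangentAngle (a : ℝ) : ℝ := Real.arccos (1 / a)

/-- The tangency point `T`. It is also the outward unit normal to the domain along the
segment from `a` to `T`. -/
noncomputable def tangentPoint (a : ℝ) : ℂ := circlePoint (tangentAngle a)

theorem tangentAngle_mem {a : ℝ} (ha : 1 < a) :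
    tangentAngle a ∈ Set.Ioo 0 (Real.pi / 2) := by
  have h0 : 0 < a := by linarith
  refine ⟨Real.arccos_pos.2 ((div_lt_one h0).2 ha), ?_⟩
  exact Real.arccos_lt_pi_div_two.2 (by positivity)

/-- The segment from `T` to `a` is orthogonal to the radius at `T`. -/
theorem tangentPoint_tangent {a : ℝ} (ha : 1 < a) :
    inner ℝ (tangentPoint a) ((a : ℂ) - tangentPoint a) = 0 := by
  have h0 : 0 < a := by linarith
  have hc : Real.cos (tangentAngle a) = 1 / a :=
    Real.cos_arccos (le_trans (by norm_num) (by positivity : (0 : ℝ) ≤ 1 / a))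
      ((div_le_one h0).2 ha.le)
  have hs := Real.sin_sq_add_cos_sq (tangentAngle a)
  have h1 : (1 / a) * a = 1 := by field_simp
  rw [Complex.inner]
  simp only [tangentPoint, circlePoint, Complex.mul_re, Complex.conj_re, Complex.conj_im,
    Complex.sub_re, Complex.sub_im, Complex.ofReal_re, Complex.ofReal_im,
    Complex.exp_ofReal_mul_I_re, Complex.exp_ofReal_mul_I_im]
  rw [hc] at hs ⊢
  nlinarith

/-- The arc of the unit circle that corresponds to the arguments in `[θ, θ + δ]`. -/
def arc (δ θ : ℝ) : Set ℂ := circlePoint '' Set.Icc θ (θ + δ)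

/-- `u` is a (classical) solution of the Dirichlet problem for the Laplace equation in the domain,
with boundary value `φ (t - θ)` at the point of argument `t` of the arc `arc δ θ` and boundary
value `0` elsewhere. -/
structure IsSolution (a δ : ℝ) (φ : ℝ → ℝ) (θ : ℝ) (u : ℂ → ℝ) : Prop where
  continuousOn : ContinuousOn u (domain a)
  harmonic : InnerProductSpace.HarmonicOnNhd u (interior (domain a))
  eq_on_arc : ∀ t ∈ Set.Icc θ (θ + δ), u (circlePoint t) = φ (t - θ)
  eq_zero : ∀ z ∈ frontier (domain a) \ arc δ θ, u z = 0

/-- `u` has outward normal derivative `d` at the boundary point `x`, where `n` is the outward unit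
normal at `x`. Only the values of `u` at `x + h n` with `h ≤ 0` enter. -/
def HasOutwardNormalDeriv (u : ℂ → ℝ) (n x : ℂ) (d : ℝ) : Prop :=
  HasDerivWithinAt (fun h : ℝ => u (x + (h : ℂ) * n)) d (Set.Iic 0) 0

end HalfCap

section

open Complex InnerProductSpace Metric Set Filter Topology MeasureTheory
open scoped Real ComplexConjugate

namespace HalfCap

/-! Put `w = u - u'`. The half disk has an explicit Poisson kernel, while the cap is controlled only
by the minimum principle. The two are glued along the arc `e^{it}`, `0 ≤ t ≤ t₀`, whose relative
interior lies inside `K`.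

Suppose that `w` has a negative minimum `m` on this arc, at `e^{is}`. Since `w` vanishes at `1` and
at `T`, `0 < s < t₀`. The rest of the boundary of the cap carries zero values, so `w ≥ m` in the cap
and the radial derivative of `w` at `e^{is}` is nonnegative. Seen from the half disk, the Poisson
formula gives a strictly negative derivative: the arc contributes at least `m`, and the boundary
part `t ∈ [t₀, π]` adds, to first order, `(1 - r) J / (2π)` with `J = ∫ normalKernel s t * w`. Here
`J > 0`, because `normalKernel s` is strictly decreasing to the right of `s` (`normalKernel_lt`) and
`u'` carries the same bump as `u`, moved to the right (`integral_normalKernel_pos`). This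
contradiction is `sub_nonneg_on_arc`.

Hence `w ≥ 0` in the cap. Equality at an interior point would force `w = 0` throughout the interior
of `K` by the identity theorem, against the boundary values (`lt_of_one_lt_norm`).

For the normal derivatives at a point of the open segment, a small half disk centred there is used:
the derivative is an integral of the function over the half circle with a positive weight. At `T`
the big half disk is used, with the same lower bound for `w` as above, now with `s = t₀` and `m =
0`; it applies because the arc stays away from `T`. -/

/-! ### Harmonic functions in the plane and the minimum principle -/

theorem harmonicAt_comp_analyticAt {u : ℂ → ℝ} {g : ℂ → ℂ} {z : ℂ} (hu : HarmonicAt u (g z))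
    (hg : AnalyticAt ℂ g z) : HarmonicAt (fun w => u (g w)) z := by
  obtain ⟨r, hr, hball⟩ := Metric.eventually_nhds_iff_ball.1 hu.eventually
  obtain ⟨F, hF, hFu⟩ :=
    InnerProductSpace.HarmonicOnNhd.exists_analyticOnNhd_ball_re_eq (z := g z) (R := r) hball
  have h1 : HarmonicAt (fun w => (F (g w)).re) z :=
    AnalyticAt.harmonicAt_re ((hF (g z) (mem_ball_self hr)).comp hg)
  refine (harmonicAt_congr_nhds ?_).1 h1
  filter_upwards [hg.continuousAt.preimage_mem_nhds (ball_mem_nhds (g z) hr)] with w hw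
  exact hFu hw

theorem harmonicOnNhd_const (c : ℝ) (s : Set ℂ) : HarmonicOnNhd (fun _ => c) s := fun z _ => by
  exact AnalyticAt.harmonicAt_re (f := fun _ => (c : ℂ)) (x := z) analyticAt_const

/-- A harmonic function is constant near a local minimum. -/
theorem eventually_eq_of_isLocalMin {u : ℂ → ℝ} {z : ℂ} (hu : HarmonicAt u z)
    (hz : IsLocalMin u z) : ∀ᶠ w in 𝓝 z, u w = u z := by
  obtain ⟨r, hr, hball⟩ := Metric.eventually_nhds_iff_ball.1 hu.eventually
  obtain ⟨F, hF, hFu⟩ :=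
    InnerProductSpace.HarmonicOnNhd.exists_analyticOnNhd_ball_re_eq (z := z) (R := r) hball
  have hb : ball z r ∈ 𝓝 z := ball_mem_nhds z hr
  -- With `u = Re F`, the modulus of `exp (-F)` is `exp (-u)`, so a minimum of `u` is a maximum of
  -- modulus of a holomorphic function.
  have hn : ∀ w ∈ ball z r, ‖cexp (-F w)‖ = Real.exp (-u w) := by
    intro w hw
    rw [Complex.norm_exp, Complex.neg_re, ← hFu hw]
  have hd : ∀ᶠ w in 𝓝 z, DifferentiableAt ℂ (fun w => cexp (-F w)) w := by
    filter_upwards [hb] with w hw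
    exact (hF w hw).differentiableAt.neg.cexp
  have hmax : IsLocalMax (norm ∘ fun w => cexp (-F w)) z := by
    filter_upwards [hb, hz] with w hw hzw
    simp only [Function.comp_apply]
    rw [hn w hw, hn z (mem_ball_self hr)]
    exact Real.exp_le_exp.2 (neg_le_neg hzw)
  filter_upwards [hb, Complex.norm_eventually_eq_of_isLocalMax hd hmax] with w hw h
  rw [hn w hw, hn z (mem_ball_self hr)] at h
  have := Real.exp_injective h
  linarith

/-- The minimum principle for harmonic functions. -/
theorem le_of_harmonicOnNhd {S U : Set ℂ} {f : ℂ → ℝ} {m : ℝ} (hS : IsCompact S)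
    (hU : IsOpen U) (hUS : U ⊆ S) (hc : ContinuousOn f S) (hf : HarmonicOnNhd f U)
    (hm : ∀ z ∈ S \ U, m ≤ f z) : ∀ z ∈ S, m ≤ f z := by
  intro z hz
  obtain ⟨z₀, hz₀, hmin⟩ := hS.exists_isMinOn ⟨z, hz⟩ hc
  have hmin' : ∀ w ∈ S, f z₀ ≤ f w := hmin
  refine le_trans ?_ (hmin' z hz)
  by_contra! hlt
  have hM : IsCompact (S ∩ f ⁻¹' {f z₀}) := by
    obtain ⟨V, hV, h⟩ := (continuousOn_iff_isClosed.1 hc) {f z₀} isClosed_singleton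
    rw [inter_comm, h, inter_comm]
    exact hS.inter_right hV
  -- Among the minimizers take one farthest to the right: were it in `U`, local constancy would
  -- produce another one farther right. No connectedness is needed.
  obtain ⟨z₁, ⟨hz₁S, hz₁⟩, hre⟩ :=
    hM.exists_isMaxOn ⟨z₀, hz₀, rfl⟩ Complex.continuous_re.continuousOn
  have hz₁' : f z₁ = f z₀ := hz₁
  have hz₁U : z₁ ∈ U := by
    by_contra h
    have := hm z₁ ⟨hz₁S, h⟩
    linarith
  have hUn : U ∈ 𝓝 z₁ := hU.mem_nhds hz₁U
  have hloc : IsLocalMin f z₁ := by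
    filter_upwards [hUn] with w hw
    rw [hz₁']
    exact hmin' w (hUS hw)
  have hev := eventually_eq_of_isLocalMin (hf z₁ hz₁U) hloc
  obtain ⟨r, hr, hball⟩ := Metric.eventually_nhds_iff_ball.1 (hev.and hUn)
  have hmem : z₁ + ((r / 2 : ℝ) : ℂ) ∈ ball z₁ r := by
    rw [mem_ball, dist_eq_norm, add_sub_cancel_left, Complex.norm_real, Real.norm_eq_abs,
      abs_of_pos (by linarith)]
    linarith
  obtain ⟨h1, h2⟩ := hball _ hmem
  have hle : (z₁ + ((r / 2 : ℝ) : ℂ)).re ≤ z₁.re := hre ⟨hUS h2, by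
    rw [mem_preimage, h1, hz₁']; rfl⟩
  rw [Complex.add_re, Complex.ofReal_re] at hle
  linarith

theorem abs_le_of_harmonicOnNhd {S U : Set ℂ} {f : ℂ → ℝ} {m : ℝ} (hS : IsCompact S)
    (hU : IsOpen U) (hUS : U ⊆ S) (hc : ContinuousOn f S) (hf : HarmonicOnNhd f U)
    (hm : ∀ z ∈ S \ U, |f z| ≤ m) : ∀ z ∈ S, |f z| ≤ m := by
  intro z hz
  have h1 := le_of_harmonicOnNhd hS hU hUS hc hf (fun z hz => (abs_le.1 (hm z hz)).1) z hz
  have h2 := le_of_harmonicOnNhd hS hU hUS hc.neg hf.neg (m := -m)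
    (fun z hz => neg_le_neg (abs_le.1 (hm z hz)).2) z hz
  exact abs_le.2 ⟨h1, by simpa using h2⟩

/-! ### The Poisson kernel of the upper half disk -/

theorem circlePoint_re (t : ℝ) : (circlePoint t).re = Real.cos t := Complex.exp_ofReal_mul_I_re t

theorem circlePoint_im (t : ℝ) : (circlePoint t).im = Real.sin t := Complex.exp_ofReal_mul_I_im t

theorem norm_circlePoint (t : ℝ) : ‖circlePoint t‖ = 1 := Complex.norm_exp_ofReal_mul_I t

theorem continuous_circlePoint : Continuous circlePoint := by
  unfold circlePoint
  fun_prop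

theorem circlePoint_neg (t : ℝ) : circlePoint (-t) = conj (circlePoint t) := by
  apply Complex.ext <;> simp [circlePoint_re, circlePoint_im]

theorem circlePoint_two_pi_sub (t : ℝ) : circlePoint (2 * π - t) = conj (circlePoint t) := by
  apply Complex.ext <;> simp [circlePoint_re, circlePoint_im]

theorem sq_norm_circlePoint_sub (t : ℝ) (z : ℂ) :
    ‖circlePoint t - z‖ ^ 2 = 1 + ‖z‖ ^ 2 - 2 * (Real.cos t * z.re + Real.sin t * z.im) := by
  rw [Complex.sq_norm, Complex.sq_norm, Complex.normSq_apply, Complex.normSq_apply]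
  simp only [sub_re, sub_im, circlePoint_re, circlePoint_im]
  linear_combination Real.sin_sq_add_cos_sq t

/-- The Poisson kernel of the upper half disk. -/
noncomputable def halfDiskKernel (z : ℂ) (t : ℝ) : ℝ :=
  (1 - ‖z‖ ^ 2) * (4 * z.im * Real.sin t) /
    (‖circlePoint t - z‖ ^ 2 * ‖circlePoint t - conj z‖ ^ 2)

theorem circlePoint_sub_ne_zero {z : ℂ} (hz : ‖z‖ < 1) (t : ℝ) : circlePoint t - z ≠ 0 := by
  intro h
  rw [sub_eq_zero] at h
  rw [← h, norm_circlePoint] at hz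
  exact lt_irrefl _ hz

/-- Method of images: subtracting the kernel of the mirror point makes the kernel vanish on the
diameter. The product form in the definition shows its sign and the factors `1 - ‖z‖ ^ 2` and
`z.im`. -/
theorem halfDiskKernel_eq {z : ℂ} (hz : ‖z‖ < 1) (t : ℝ) :
    halfDiskKernel z t =
      poissonKernel 0 z (circlePoint t) - poissonKernel 0 (conj z) (circlePoint t) := by
  have h1 : ‖circlePoint t - z‖ ^ 2 ≠ 0 := by
    simpa using circlePoint_sub_ne_zero hz t
  have h2 : ‖circlePoint t - conj z‖ ^ 2 ≠ 0 := by
    simpa using circlePoint_sub_ne_zero (z := conj z) (by simpa using hz) t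
  simp only [poissonKernel, sub_zero, norm_circlePoint, Complex.norm_conj, halfDiskKernel]
  rw [div_sub_div _ _ h1 h2]
  congr 1
  rw [sq_norm_circlePoint_sub, sq_norm_circlePoint_sub]
  simp only [Complex.norm_conj, Complex.conj_re, Complex.conj_im]
  ring

theorem halfDiskKernel_nonneg {z : ℂ} (hz : ‖z‖ < 1) (hz' : 0 ≤ z.im) {t : ℝ}
    (ht : t ∈ Icc 0 π) : 0 ≤ halfDiskKernel z t := by
  have := Real.sin_nonneg_of_mem_Icc ht
  have : 0 ≤ 1 - ‖z‖ ^ 2 := by nlinarith [norm_nonneg z]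
  unfold halfDiskKernel
  positivity

theorem continuous_poissonKernel_circlePoint {z : ℂ} (hz : ‖z‖ < 1) :
    Continuous fun t => poissonKernel 0 z (circlePoint t) := by
  unfold poissonKernel
  have := continuous_circlePoint
  refine Continuous.div (by fun_prop) (by fun_prop) fun t => ?_
  simpa using circlePoint_sub_ne_zero hz t

theorem continuous_halfDiskKernel {z : ℂ} (hz : ‖z‖ < 1) : Continuous (halfDiskKernel z) := by
  rw [funext (halfDiskKernel_eq hz)]
  exact (continuous_poissonKernel_circlePoint hz).sub
    (continuous_poissonKernel_circlePoint (by simpa using hz))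

theorem poissonKernel_conj_conj (z ζ : ℂ) :
    poissonKernel 0 (conj z) (conj ζ) = poissonKernel 0 z ζ := by
  simp only [poissonKernel, sub_zero, Complex.norm_conj, ← map_sub]

theorem integral_poissonKernel {f : ℂ → ℝ} (hf : HarmonicOnNhd f (closedBall 0 1)) {z : ℂ}
    (hz : ‖z‖ < 1) :
    ∫ t in (0 : ℝ)..2 * π, poissonKernel 0 z (circlePoint t) * f (circlePoint t) =
      2 * π * f z := by
  have h := HarmonicOnNhd.circleAverage_poissonKernel_smul (w := z) hf (by simpa using hz)
  have hm : ∀ t : ℝ, circleMap 0 1 t = circlePoint t := fun t => by simp [circleMap, circlePoint]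
  rw [Real.circleAverage_def] at h
  simp only [hm, Pi.smul_apply', smul_eq_mul] at h
  rw [← h]
  field_simp

/-- The disk kernel has total mass `2 * π` in this normalization; the image term and the lower half
circle are discarded, both being nonnegative. -/
theorem integral_halfDiskKernel_le {z : ℂ} (hz : ‖z‖ < 1) :
    ∫ t in (0 : ℝ)..π, halfDiskKernel z t ≤ 2 * π := by
  have hpi := Real.pi_pos
  have h := integral_poissonKernel (f := fun _ => 1) (z := z)
    (harmonicOnNhd_const 1 _) hz
  simp only [mul_one] at h
  have hz' : ‖conj z‖ < 1 := by simpa using hz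
  have hp : ∀ {z : ℂ}, ‖z‖ < 1 → ∀ t, 0 ≤ poissonKernel 0 z (circlePoint t) := by
    intro z hz t
    simp only [poissonKernel, sub_zero, norm_circlePoint]
    have : 0 ≤ 1 - ‖z‖ ^ 2 := by nlinarith [norm_nonneg z]
    rw [one_pow]
    positivity
  have hc := continuous_poissonKernel_circlePoint hz
  rw [← h, ← intervalIntegral.integral_add_adjacent_intervals (hc.intervalIntegrable 0 π)
    (hc.intervalIntegrable π (2 * π))]
  have h2 : 0 ≤ ∫ t in π..2 * π, poissonKernel 0 z (circlePoint t) :=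
    intervalIntegral.integral_nonneg (by linarith) fun t _ => hp hz t
  have h3 : ∫ t in (0 : ℝ)..π, halfDiskKernel z t ≤
      ∫ t in (0 : ℝ)..π, poissonKernel 0 z (circlePoint t) := by
    refine intervalIntegral.integral_mono_on hpi.le
      ((continuous_halfDiskKernel hz).intervalIntegrable _ _) (hc.intervalIntegrable _ _) ?_
    intro t _
    rw [halfDiskKernel_eq hz]
    linarith [hp hz' t]
  linarith

/-- The Poisson formula for a harmonic function that is odd under conjugation. -/
theorem integral_halfDiskKernel_of_odd {f : ℂ → ℝ} (hf : HarmonicOnNhd f univ)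
    (hodd : ∀ z, f (conj z) = -f z) {z : ℂ} (hz : ‖z‖ < 1) :
    ∫ t in (0 : ℝ)..π, halfDiskKernel z t * f (circlePoint t) = 2 * π * f z := by
  have hfc : Continuous f :=
    continuous_iff_continuousAt.2 fun w => (hf w (mem_univ w)).1.continuousAt
  have hz' : ‖conj z‖ < 1 := by simpa using hz
  have hc : ∀ {z : ℂ}, ‖z‖ < 1 →
      Continuous fun t => poissonKernel 0 z (circlePoint t) * f (circlePoint t) := fun hz =>
    (continuous_poissonKernel_circlePoint hz).mul (hfc.comp continuous_circlePoint)
  rw [← integral_poissonKernel (hf.mono (subset_univ _)) hz,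
    ← intervalIntegral.integral_add_adjacent_intervals ((hc hz).intervalIntegrable 0 π)
    ((hc hz).intervalIntegrable π (2 * π))]
  -- The substitution `t ↦ 2 * π - t` is conjugation on the circle; oddness of `f` turns the lower
  -- half circle into the image term.
  have h1 : ∫ t in π..2 * π, poissonKernel 0 z (circlePoint t) * f (circlePoint t) =
      - ∫ t in (0 : ℝ)..π, poissonKernel 0 (conj z) (circlePoint t) * f (circlePoint t) := by
    have h := intervalIntegral.integral_comp_sub_left (a := 0) (b := π)
      (fun t => poissonKernel 0 z (circlePoint t) * f (circlePoint t)) (2 * π)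
    have e : 2 * π - π = π := by ring
    rw [e, sub_zero] at h
    rw [← h, ← intervalIntegral.integral_neg]
    refine intervalIntegral.integral_congr fun t _ => ?_
    simp only [circlePoint_two_pi_sub, hodd]
    rw [← poissonKernel_conj_conj, Complex.conj_conj]
    ring
  rw [h1, ← sub_eq_add_neg, ← intervalIntegral.integral_sub ((hc hz).intervalIntegrable _ _)
    ((hc hz').intervalIntegrable _ _)]
  refine intervalIntegral.integral_congr fun t _ => ?_
  simp only [halfDiskKernel_eq hz]
  ring

-- The Poisson formula for the half disk, by odd trigonometric approximation

local instance : Fact (0 < 2 * π) := ⟨Real.two_pi_pos⟩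

theorem fourier_eq_circlePoint_zpow (n : ℤ) (t : ℝ) :
    fourier n ((t : ℝ) : AddCircle (2 * π)) = circlePoint t ^ n := by
  rw [fourier_coe_apply, circlePoint, ← Complex.exp_int_mul]
  congr 1
  have : (π : ℂ) ≠ 0 := by exact_mod_cast Real.pi_ne_zero
  push_cast
  field_simp

/-- The antisymmetric part of a trigonometric polynomial has a harmonic extension that is odd under
conjugation. -/
theorem exists_odd_harmonic_of_mem_span {f : C(AddCircle (2 * π), ℂ)}
    (hf : f ∈ Submodule.span ℂ (range (@fourier (2 * π)))) :
    ∃ F₁ F₂ : ℂ → ℝ, HarmonicOnNhd F₁ univ ∧ HarmonicOnNhd F₂ univ ∧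
      (∀ z, F₁ (conj z) = -F₁ z) ∧ (∀ z, F₂ (conj z) = -F₂ z) ∧
      ∀ t : ℝ, f ((t : ℝ) : AddCircle (2 * π)) - f ((-t : ℝ) : AddCircle (2 * π)) =
        (F₁ (circlePoint t) : ℂ) + F₂ (circlePoint t) * I := by
  induction hf using Submodule.span_induction with
  | mem f hf =>
    obtain ⟨n, rfl⟩ := hf
    have key : ∀ (k : ℕ) (c : ℝ), HarmonicOnNhd (fun z : ℂ => c * (z ^ k).im) univ := by
      intro k c z _
      have h := (AnalyticAt.harmonicAt_im (f := fun z : ℂ => z ^ k) (x := z) (by fun_prop))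
      exact h.const_smul (c := c)
    have hodd : ∀ (k : ℕ) (c : ℝ) (z : ℂ), c * ((conj z) ^ k).im = -(c * (z ^ k).im) := by
      intro k c z
      rw [← map_pow, Complex.conj_im]
      ring
    have hinv : ∀ t : ℝ, (circlePoint t)⁻¹ = conj (circlePoint t) := by
      intro t
      rw [Complex.inv_def, Complex.normSq_eq_norm_sq, norm_circlePoint]
      simp
    have hinv' : ∀ t : ℝ, (conj (circlePoint t))⁻¹ = circlePoint t := by
      intro t
      rw [← hinv, inv_inv]
    -- `e^{int} - e^{-int} = 2i sin (nt)` is purely imaginary, and `sin (|n| t)` is the boundary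
    -- value of `Im z ^ |n|`; the sign of `n` gives `±2`.
    refine ⟨fun _ => 0, fun z => (if 0 ≤ n then 2 else -2) * (z ^ n.natAbs).im,
      harmonicOnNhd_const 0 _, key _ _, by simp, hodd _ _, fun t => ?_⟩
    rw [fourier_eq_circlePoint_zpow, fourier_eq_circlePoint_zpow, circlePoint_neg]
    rcases le_or_gt 0 n with h | h
    · obtain ⟨k, rfl⟩ := Int.eq_ofNat_of_zero_le h
      simp only [zpow_natCast, ← map_pow, Int.natAbs_natCast, if_pos h]
      rw [Complex.sub_conj]
      push_cast
      ring
    · obtain ⟨k, hk⟩ := Int.eq_ofNat_of_zero_le (a := -n) (by omega)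
      obtain rfl : n = -(k : ℤ) := by omega
      simp only [zpow_neg, zpow_natCast, ← inv_pow, hinv, hinv', Int.natAbs_neg,
        Int.natAbs_natCast, if_neg (not_le.2 h)]
      rw [← map_pow, ← neg_sub, Complex.sub_conj]
      push_cast
      ring
  | zero =>
    exact ⟨fun _ => 0, fun _ => 0, harmonicOnNhd_const 0 _,
      harmonicOnNhd_const 0 _, by simp, by simp, by simp⟩
  | add f g _ _ hf hg =>
    obtain ⟨F₁, F₂, h1, h2, h3, h4, h5⟩ := hf
    obtain ⟨G₁, G₂, k1, k2, k3, k4, k5⟩ := hg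
    refine ⟨F₁ + G₁, F₂ + G₂, h1.add k1, h2.add k2, fun z => ?_, fun z => ?_, fun t => ?_⟩
    · simp only [Pi.add_apply, h3, k3]; ring
    · simp only [Pi.add_apply, h4, k4]; ring
    · simp only [ContinuousMap.add_apply, Pi.add_apply]
      push_cast
      linear_combination h5 t + k5 t
  | smul c f _ hf =>
    obtain ⟨F₁, F₂, h1, h2, h3, h4, h5⟩ := hf
    refine ⟨c.re • F₁ - c.im • F₂, c.im • F₁ + c.re • F₂,
      (h1.const_smul (c := c.re)).sub (h2.const_smul (c := c.im)),
      (h1.const_smul (c := c.im)).add (h2.const_smul (c := c.re)),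
      fun z => ?_, fun z => ?_, fun t => ?_⟩
    · simp only [Pi.sub_apply, Pi.smul_apply, smul_eq_mul, h3, h4]; ring
    · simp only [Pi.add_apply, Pi.smul_apply, smul_eq_mul, h3, h4]; ring
    · simp only [ContinuousMap.smul_apply, Pi.add_apply, Pi.sub_apply, Pi.smul_apply, smul_eq_mul]
      rw [← mul_sub, h5 t]
      conv_lhs => rw [← Complex.re_add_im c]
      push_cast
      linear_combination (c.im : ℂ) * F₂ (circlePoint t) * Complex.I_mul_I

theorem isCompact_upperHalfDisk : IsCompact upperHalfDisk := by
  have : upperHalfDisk = closedBall (0 : ℂ) 1 ∩ {z | 0 ≤ z.im} := by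
    ext z; simp [upperHalfDisk]
  rw [this]
  exact (isCompact_closedBall _ _).inter_right (isClosed_le continuous_const continuous_im)

theorem circlePoint_mem_upperHalfDisk {t : ℝ} (ht : t ∈ Icc 0 π) :
    circlePoint t ∈ upperHalfDisk :=
  ⟨(norm_circlePoint t).le, by rw [circlePoint_im]; exact Real.sin_nonneg_of_mem_Icc ht⟩

theorem exists_circlePoint_eq {z : ℂ} (hz : ‖z‖ = 1) (hz' : 0 ≤ z.im) :
    z = circlePoint (Real.arccos z.re) := by
  have h1 : z.re ^ 2 + z.im ^ 2 = 1 := by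
    have := Complex.sq_norm z
    rw [hz, Complex.normSq_apply] at this
    linarith
  have h2 : -1 ≤ z.re := by nlinarith
  have h3 : z.re ≤ 1 := by nlinarith
  apply Complex.ext
  · rw [circlePoint_re, Real.cos_arccos h2 h3]
  · rw [circlePoint_im, Real.sin_arccos, ← Real.sqrt_sq hz']
    congr 1
    linarith

/-- A function that is continuous on the closed upper half disk, harmonic in its interior, and
zero on the diameter. -/
structure IsHalfDiskHarmonic (g : ℂ → ℝ) : Prop where
  continuousOn : ContinuousOn g upperHalfDisk
  harmonic : HarmonicOnNhd g {z | ‖z‖ < 1 ∧ 0 < z.im}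
  eq_zero : ∀ z : ℂ, ‖z‖ ≤ 1 → z.im = 0 → g z = 0

theorem IsHalfDiskHarmonic.sub {f g : ℂ → ℝ} (hf : IsHalfDiskHarmonic f)
    (hg : IsHalfDiskHarmonic g) : IsHalfDiskHarmonic (fun z => f z - g z) where
  continuousOn := hf.continuousOn.sub hg.continuousOn
  harmonic := hf.harmonic.sub hg.harmonic
  eq_zero z h h' := by rw [hf.eq_zero z h h', hg.eq_zero z h h', sub_zero]

/-- Extend the boundary values of `g` by zero to the lower half circle, approximate by a
trigonometric polynomial and antisymmetrize. The odd harmonic extension vanishes on the diameter, as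
`g` does, and is close to `g` on the half circle, so the maximum principle spreads the estimate to
the half disk. -/
theorem IsHalfDiskHarmonic.exists_approx {g : ℂ → ℝ} (hg : IsHalfDiskHarmonic g) {ε : ℝ}
    (hε : 0 < ε) : ∃ F : ℂ → ℝ, HarmonicOnNhd F univ ∧ (∀ z, F (conj z) = -F z) ∧
      ∀ z ∈ upperHalfDisk, |F z - g z| ≤ ε := by
  -- Folding the lower half plane onto the real axis, where `g` vanishes, implements the continuous
  -- extension by zero.
  let ρ : ℂ → ℂ := fun z => z.re + (max z.im 0 : ℝ) * I
  have hρre : ∀ z, (ρ z).re = z.re := fun z => by simp [ρ]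
  have hρim : ∀ z, (ρ z).im = max z.im 0 := fun z => by simp [ρ]
  have hρn : ∀ z, ‖ρ z‖ ≤ ‖z‖ := by
    intro z
    rw [← sq_le_sq₀ (norm_nonneg _) (norm_nonneg _), Complex.sq_norm, Complex.sq_norm,
      Complex.normSq_apply, Complex.normSq_apply, hρre, hρim]
    rcases le_total z.im 0 with h | h
    · rw [max_eq_right h]; nlinarith
    · rw [max_eq_left h]
  have hρc : Continuous ρ := by fun_prop
  let G : C(AddCircle (2 * π), ℂ) :=
    ⟨fun x => ((g (ρ (AddCircle.toCircle x)) : ℝ) : ℂ), by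
      refine continuous_ofReal.comp (hg.continuousOn.comp_continuous ?_ ?_)
      · exact hρc.comp (continuous_subtype_val.comp AddCircle.continuous_toCircle)
      · intro x
        refine ⟨(hρn _).trans ?_, ?_⟩
        · exact (Circle.norm_coe _).le
        · rw [hρim]; exact le_max_right _ _⟩
  have hGt : ∀ t : ℝ, G (t : AddCircle (2 * π)) = g (ρ (circlePoint t)) := by
    intro t
    change ((g (ρ (AddCircle.toCircle (t : AddCircle (2 * π)))) : ℝ) : ℂ) = _
    rw [AddCircle.toCircle_apply_mk, div_self Real.two_pi_pos.ne', one_mul, Circle.coe_exp]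
    rfl
  have hGmem : G ∈ closure ((Submodule.span ℂ (range (@fourier (2 * π))) :
      Submodule ℂ C(AddCircle (2 * π), ℂ)) : Set C(AddCircle (2 * π), ℂ)) := by
    rw [← Submodule.topologicalClosure_coe, span_fourier_closure_eq_top]
    trivial
  -- The antisymmetric part involves two values of `f`, at `t` and `-t`, hence `ε / 2` for each.
  obtain ⟨f, hf, hfG⟩ := Metric.mem_closure_iff.1 hGmem (ε / 2) (by linarith)
  obtain ⟨F, F₂, hF, -, hodd, -, hFf⟩ := exists_odd_harmonic_of_mem_span hf
  refine ⟨F, hF, hodd, ?_⟩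
  have hFc : Continuous F :=
    continuous_iff_continuousAt.2 fun w => (hF w (mem_univ w)).1.continuousAt
  have hUo : IsOpen {z : ℂ | ‖z‖ < 1 ∧ 0 < z.im} :=
    (isOpen_lt continuous_norm continuous_const).inter (isOpen_lt continuous_const continuous_im)
  refine abs_le_of_harmonicOnNhd (f := fun z => F z - g z) isCompact_upperHalfDisk hUo
    (fun z hz => ⟨hz.1.le, hz.2.le⟩) (hFc.continuousOn.sub hg.continuousOn)
    ((hF.mono (subset_univ _)).sub hg.harmonic) ?_
  rintro z ⟨⟨hz1, hz2⟩, hz3⟩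
  rcases hz2.eq_or_lt with h0 | h0
  · have hF0 : F z = 0 := by
      have h := hodd z
      rw [Complex.conj_eq_iff_im.2 h0.symm] at h
      linarith
    rw [hF0, hg.eq_zero z hz1 h0.symm]
    simpa using hε.le
  · have hz4 : ‖z‖ = 1 := le_antisymm hz1 (not_lt.1 fun h => hz3 ⟨h, h0⟩)
    set t := Real.arccos z.re
    have hzt : z = circlePoint t := exists_circlePoint_eq hz4 hz2
    have hs : 0 < Real.sin t := by rw [hzt, circlePoint_im] at h0; exact h0
    have e1 : ρ (circlePoint t) = circlePoint t := by
      apply Complex.ext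
      · rw [hρre]
      · rw [hρim, circlePoint_im, max_eq_left hs.le]
    have e2 : g (ρ (circlePoint (-t))) = 0 := by
      refine hg.eq_zero _ ((hρn _).trans (norm_circlePoint _).le) ?_
      rw [hρim, circlePoint_im, Real.sin_neg, max_eq_right (by linarith)]
    have d : ∀ x, ‖f x - G x‖ ≤ ε / 2 := by
      intro x
      rw [← dist_eq_norm, dist_comm]
      exact (ContinuousMap.dist_apply_le_dist x).trans hfG.le
    have h1 := d (t : AddCircle (2 * π))
    have h2 := d ((-t : ℝ) : AddCircle (2 * π))
    rw [hGt, e1] at h1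
    rw [hGt, e2] at h2
    have h3 := (Complex.abs_re_le_norm _).trans h1
    have h4 := (Complex.abs_re_le_norm _).trans h2
    have h5 := congrArg Complex.re (hFf t)
    simp only [sub_re, add_re, mul_re, ofReal_re, ofReal_im, I_re, I_im] at h3 h4 h5
    rw [hzt]
    rw [abs_le] at *
    constructor <;> linarith [h3.1, h3.2, h4.1, h4.2]

theorem IsHalfDiskHarmonic.continuousOn_circlePoint {g : ℂ → ℝ} (hg : IsHalfDiskHarmonic g) :
    ContinuousOn (fun t => g (circlePoint t)) (Icc 0 π) :=
  hg.continuousOn.comp continuous_circlePoint.continuousOn fun _ ht =>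
    circlePoint_mem_upperHalfDisk ht

theorem IsHalfDiskHarmonic.intervalIntegrable {g : ℂ → ℝ} (hg : IsHalfDiskHarmonic g) {z : ℂ}
    (hz : ‖z‖ < 1) :
    IntervalIntegrable (fun t => halfDiskKernel z t * g (circlePoint t)) volume 0 π := by
  refine ContinuousOn.intervalIntegrable_of_Icc Real.pi_pos.le ?_
  exact (continuous_halfDiskKernel hz).continuousOn.mul hg.continuousOn_circlePoint

/-- The Poisson formula for the upper half disk. -/
theorem IsHalfDiskHarmonic.integral_halfDiskKernel {g : ℂ → ℝ} (hg : IsHalfDiskHarmonic g)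
    {z : ℂ} (hz : ‖z‖ < 1) (hz' : 0 ≤ z.im) :
    ∫ t in (0 : ℝ)..π, halfDiskKernel z t * g (circlePoint t) = 2 * π * g z := by
  have hpi := Real.pi_pos
  rw [← sub_eq_zero, ← abs_nonpos_iff]
  refine le_of_forall_pos_le_add fun ε hε => ?_
  rw [zero_add]
  -- Since the kernel has mass at most `2 * π`, replacing `g` by `F` costs at most `ε / 2` on each
  -- side of the formula.
  obtain ⟨F, hF, hodd, hFg⟩ := hg.exists_approx (ε := ε / (4 * π)) (by positivity)
  have hFc : Continuous F :=
    continuous_iff_continuousAt.2 fun w => (hF w (mem_univ w)).1.continuousAt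
  have h1 := integral_halfDiskKernel_of_odd hF hodd hz
  have hi := hg.intervalIntegrable hz
  have hiF : IntervalIntegrable (fun t => halfDiskKernel z t * F (circlePoint t)) volume 0 π :=
    ((continuous_halfDiskKernel hz).mul (hFc.comp continuous_circlePoint)).intervalIntegrable _ _
  have h2 : |∫ t in (0 : ℝ)..π, (halfDiskKernel z t * F (circlePoint t) -
      halfDiskKernel z t * g (circlePoint t))| ≤
      ∫ t in (0 : ℝ)..π, halfDiskKernel z t * (ε / (4 * π)) := by
    rw [← Real.norm_eq_abs]
    refine intervalIntegral.norm_integral_le_of_norm_le hpi.le (ae_of_all _ fun t ht => ?_)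
      (((continuous_halfDiskKernel hz).mul continuous_const).intervalIntegrable _ _)
    have ht' : t ∈ Icc 0 π := ⟨ht.1.le, ht.2⟩
    rw [← mul_sub, norm_mul, Real.norm_of_nonneg (halfDiskKernel_nonneg hz hz' ht')]
    exact mul_le_mul_of_nonneg_left (hFg _ (circlePoint_mem_upperHalfDisk ht'))
      (halfDiskKernel_nonneg hz hz' ht')
  rw [intervalIntegral.integral_sub hiF hi, intervalIntegral.integral_mul_const, h1] at h2
  have h3 : (∫ t in (0 : ℝ)..π, halfDiskKernel z t) * (ε / (4 * π)) ≤ ε / 2 := by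
    calc _ ≤ 2 * π * (ε / (4 * π)) :=
          mul_le_mul_of_nonneg_right (integral_halfDiskKernel_le hz) (by positivity)
      _ = ε / 2 := by field_simp; ring
  have h4 := hFg z ⟨hz.le, hz'⟩
  have h5 : |2 * π * (F z - g z)| ≤ ε / 2 := by
    rw [abs_mul, abs_of_pos (by positivity : 0 < 2 * π)]
    calc _ ≤ 2 * π * (ε / (4 * π)) := mul_le_mul_of_nonneg_left h4 (by positivity)
      _ = ε / 2 := by field_simp; ring
  have h6 := h2.trans h3
  rw [abs_le] at *
  constructor <;> linarith [h5.1, h5.2, h6.1, h6.2]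

/-! ### Boundary derivatives of the half-disk Poisson integral -/

theorem im_mul_circlePoint (r s : ℝ) : ((r : ℂ) * circlePoint s).im = r * Real.sin s := by
  simp [circlePoint_im]

theorem re_mul_circlePoint (r s : ℝ) : ((r : ℂ) * circlePoint s).re = r * Real.cos s := by
  simp [circlePoint_re]

theorem norm_mul_circlePoint {r : ℝ} (hr : 0 ≤ r) (s : ℝ) : ‖(r : ℂ) * circlePoint s‖ = r := by
  rw [norm_mul, norm_circlePoint, mul_one, Complex.norm_real, Real.norm_of_nonneg hr]

theorem halfDiskKernel_mul_circlePoint {r : ℝ} (hr : 0 ≤ r) (hr1 : r < 1) (s t : ℝ) :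
    halfDiskKernel (r * circlePoint s) t / (1 - r) =
      (1 + r) * (4 * r * Real.sin s * Real.sin t) /
        ((1 + r ^ 2 - 2 * r * Real.cos (t - s)) * (1 + r ^ 2 - 2 * r * Real.cos (t + s))) := by
  have h1 : (1 - r) ≠ 0 := by linarith
  rw [halfDiskKernel, sq_norm_circlePoint_sub, sq_norm_circlePoint_sub, Complex.norm_conj,
    Complex.conj_re, Complex.conj_im, norm_mul_circlePoint hr, im_mul_circlePoint,
    re_mul_circlePoint, Real.cos_sub, Real.cos_add, div_right_comm]
  congr 1
  · field_simp
    ring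
  · ring

theorem halfDiskKernel_I_mul {y : ℝ} (hy : 0 < y) (t : ℝ) :
    halfDiskKernel (y * I) t / y = (1 - y ^ 2) * (4 * Real.sin t) /
      ((1 + y ^ 2 - 2 * y * Real.sin t) * (1 + y ^ 2 + 2 * y * Real.sin t)) := by
  have hn : ‖(y : ℂ) * I‖ = y := by simp [abs_of_pos hy]
  rw [halfDiskKernel, sq_norm_circlePoint_sub, sq_norm_circlePoint_sub, Complex.norm_conj,
    Complex.conj_re, Complex.conj_im, hn, div_right_comm]
  have h1 : ((y : ℂ) * I).im = y := by simp
  have h2 : ((y : ℂ) * I).re = 0 := by simp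
  rw [h1, h2]
  congr 1
  · field_simp
  · ring

/-- The normal derivative at the center of the diameter. -/
theorem IsHalfDiskHarmonic.tendsto_div_center {g : ℂ → ℝ} (hg : IsHalfDiskHarmonic g) :
    Tendsto (fun y : ℝ => g (y * I) / y) (𝓝[>] 0)
      (𝓝 ((2 * π)⁻¹ * ∫ t in (0 : ℝ)..π, 4 * Real.sin t * g (circlePoint t))) := by
  have hpi := Real.pi_pos
  have hlt : ∀ᶠ y : ℝ in 𝓝[>] 0, 0 < y ∧ y < 1 / 2 :=
    Ioo_mem_nhdsGT (by norm_num : (0 : ℝ) < 1 / 2)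
  have hn : ∀ y : ℝ, 0 < y → ‖(y : ℂ) * I‖ = y := fun y hy => by simp [abs_of_pos hy]
  have hgc := hg.continuousOn_circlePoint
  have key : Tendsto (fun y : ℝ => ∫ t in (0 : ℝ)..π,
      halfDiskKernel (y * I) t / y * g (circlePoint t)) (𝓝[>] 0)
      (𝓝 (∫ t in (0 : ℝ)..π, 4 * Real.sin t * g (circlePoint t))) := by
    refine intervalIntegral.tendsto_integral_filter_of_dominated_convergence
      -- For `y < 1 / 2` both factors of the denominator are at least `1 / 4` and the numerator is
      -- at most `4`.
      (fun t => 64 * |g (circlePoint t)|) ?_ ?_ ?_ ?_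
    · filter_upwards [hlt] with y hy
      rw [uIoc_of_le hpi.le]
      refine ContinuousOn.aestronglyMeasurable ?_ measurableSet_Ioc
      refine ContinuousOn.mul ?_ (hgc.mono Ioc_subset_Icc_self)
      exact ((continuous_halfDiskKernel (by rw [hn y hy.1]; linarith)).div_const _).continuousOn
    · filter_upwards [hlt] with y hy
      refine ae_of_all _ fun t _ => ?_
      rw [halfDiskKernel_I_mul hy.1, norm_mul, Real.norm_eq_abs (g _)]
      refine mul_le_mul_of_nonneg_right ?_ (abs_nonneg _)
      have s1 := Real.sin_le_one t
      have s2 := Real.neg_one_le_sin t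
      have h1 : 1 / 4 ≤ 1 + y ^ 2 - 2 * y * Real.sin t := by nlinarith
      have h2 : 1 / 4 ≤ 1 + y ^ 2 + 2 * y * Real.sin t := by nlinarith
      rw [norm_div, Real.norm_of_nonneg (mul_nonneg (by linarith) (by linarith) :
        0 ≤ (1 + y ^ 2 - 2 * y * Real.sin t) * (1 + y ^ 2 + 2 * y * Real.sin t)),
        div_le_iff₀ (mul_pos (by linarith) (by linarith))]
      have h3 : ‖(1 - y ^ 2) * (4 * Real.sin t)‖ ≤ 4 := by
        rw [norm_mul, norm_mul, Real.norm_eq_abs, Real.norm_eq_abs, Real.norm_eq_abs]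
        have := Real.abs_sin_le_one t
        have h5 : |1 - y ^ 2| ≤ 1 := by rw [abs_le]; constructor <;> nlinarith
        have h6 : |(4 : ℝ)| = 4 := by norm_num
        rw [h6]
        calc |1 - y ^ 2| * (4 * |Real.sin t|) ≤ 1 * (4 * 1) := by gcongr
          _ = 4 := by norm_num
      nlinarith
    · refine ContinuousOn.intervalIntegrable_of_Icc hpi.le ?_
      exact continuousOn_const.mul hgc.abs
    · refine ae_of_all _ fun t _ => ?_
      have hc : ContinuousAt (fun y : ℝ => (1 - y ^ 2) * (4 * Real.sin t) /
          ((1 + y ^ 2 - 2 * y * Real.sin t) * (1 + y ^ 2 + 2 * y * Real.sin t)) *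
            g (circlePoint t)) 0 := by
        refine ContinuousAt.mul (ContinuousAt.div (by fun_prop) (by fun_prop) ?_) continuousAt_const
        norm_num
      have h := hc.tendsto.mono_left (nhdsWithin_le_nhds (s := Ioi 0))
      norm_num at h
      refine h.congr' ?_
      filter_upwards [self_mem_nhdsWithin] with y hy
      rw [halfDiskKernel_I_mul hy]
  refine (key.const_mul (2 * π)⁻¹).congr' ?_
  filter_upwards [hlt] with y hy
  have h := hg.integral_halfDiskKernel (z := y * I) (by rw [hn y hy.1]; linarith)
    (by simpa using hy.1.le)
  have e : g (y * I) = (2 * π)⁻¹ * ∫ t in (0 : ℝ)..π,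
      halfDiskKernel (y * I) t * g (circlePoint t) := by
    rw [h]; field_simp
  rw [e, mul_div_assoc, ← intervalIntegral.integral_div]
  congr 1
  refine intervalIntegral.integral_congr fun t _ => ?_
  ring

/-- The radial derivative of `halfDiskKernel` on the circle. -/
noncomputable def normalKernel (s t : ℝ) : ℝ :=
  2 * Real.sin s * Real.sin t / (Real.cos s - Real.cos t) ^ 2

/-- After division by `1 - r` the kernel develops the singularity `1 / (1 - cos (t - s))` at `t =
s`. The bound on `f` cancels exactly this, which makes dominated convergence available even when `s`
lies in `[α, β]`. -/
theorem tendsto_integral_halfDiskKernel {s α β C : ℝ} {f : ℝ → ℝ} (hs : s ∈ Ioo 0 π)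
    (hα : 0 ≤ α) (hαβ : α ≤ β) (hβ : β ≤ π) (hf : ContinuousOn f (Icc α β))
    (hC : ∀ t ∈ Icc α β, |f t| ≤ C * (1 - Real.cos (t - s))) :
    Tendsto (fun r : ℝ => (∫ t in α..β, halfDiskKernel (r * circlePoint s) t * f t) / (1 - r))
      (𝓝[<] 1) (𝓝 (∫ t in α..β, normalKernel s t * f t)) := by
  have hss : 0 < Real.sin s := Real.sin_pos_of_mem_Ioo hs
  have hlt : ∀ᶠ r : ℝ in 𝓝[<] 1, 1 / 2 < r ∧ r < 1 :=
    Ioo_mem_nhdsLT (by norm_num : (1 / 2 : ℝ) < 1)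
  have key : Tendsto (fun r : ℝ => ∫ t in α..β,
      halfDiskKernel (r * circlePoint s) t / (1 - r) * f t) (𝓝[<] 1)
      (𝓝 (∫ t in α..β, normalKernel s t * f t)) := by
    refine intervalIntegral.tendsto_integral_filter_of_dominated_convergence
      -- For `1 / 2 < r < 1` the numerator is at most `8`, the first denominator factor absorbs `|f
      -- t|` up to `|C|`, and the second is at least `sin s ^ 2 / 4`.
      (fun _ => 32 * |C| / Real.sin s ^ 2) ?_ ?_ intervalIntegrable_const ?_
    · filter_upwards [hlt] with r hr
      rw [uIoc_of_le hαβ]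
      refine ContinuousOn.aestronglyMeasurable ?_ measurableSet_Ioc
      refine ContinuousOn.mul ?_ (hf.mono Ioc_subset_Icc_self)
      exact ((continuous_halfDiskKernel (by
        rw [norm_mul_circlePoint (by linarith)]; exact hr.2)).div_const _).continuousOn
    · filter_upwards [hlt] with r hr
      refine ae_of_all _ fun t ht => ?_
      rw [uIoc_of_le hαβ] at ht
      have ht' : t ∈ Icc α β := ⟨ht.1.le, ht.2⟩
      have hst : 0 ≤ Real.sin t :=
        Real.sin_nonneg_of_mem_Icc ⟨hα.trans ht'.1, ht'.2.trans hβ⟩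
      have hst1 := Real.sin_le_one t
      have hss1 := Real.sin_le_one s
      have hcos := Real.cos_le_one (t - s)
      have hA : 1 - Real.cos (t - s) ≤ 1 + r ^ 2 - 2 * r * Real.cos (t - s) := by
        nlinarith [mul_nonneg (by linarith : (0 : ℝ) ≤ 2 * r - 1) (sub_nonneg.2 hcos)]
      have hA0 : 0 < 1 + r ^ 2 - 2 * r * Real.cos (t - s) := by
        nlinarith [mul_nonneg (by linarith : (0 : ℝ) ≤ 2 * r) (sub_nonneg.2 hcos)]
      have hB : (Real.sin s) ^ 2 / 4 ≤ 1 + r ^ 2 - 2 * r * Real.cos (t + s) := by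
        rw [Real.cos_add]
        have e1 := Real.sin_sq_add_cos_sq t
        have e2 := Real.sin_sq_add_cos_sq s
        have : (1 + r ^ 2 - 2 * r * (Real.cos t * Real.cos s - Real.sin t * Real.sin s)) =
            (Real.cos t - r * Real.cos s) ^ 2 + (Real.sin t + r * Real.sin s) ^ 2 := by
          linear_combination -e1 - r ^ 2 * e2
        rw [this]
        have h1 : Real.sin s / 2 ≤ Real.sin t + r * Real.sin s := by nlinarith
        nlinarith [sq_nonneg (Real.cos t - r * Real.cos s)]
      have hB0 : 0 < Real.sin s ^ 2 / 4 := by positivity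
      rw [halfDiskKernel_mul_circlePoint (by linarith) hr.2, norm_mul, norm_div,
        Real.norm_of_nonneg (mul_pos hA0 (hB0.trans_le hB)).le, Real.norm_eq_abs (f t),
        Real.norm_of_nonneg (by
          have : 0 < r := by linarith
          positivity : 0 ≤ (1 + r) * (4 * r * Real.sin s * Real.sin t))]
      have hnum : (1 + r) * (4 * r * Real.sin s * Real.sin t) ≤ 8 := by
        have hr0 : 0 ≤ r := by linarith
        calc (1 + r) * (4 * r * Real.sin s * Real.sin t) ≤ (1 + 1) * (4 * 1 * 1 * 1) := by
              gcongr <;> linarith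
          _ = 8 := by norm_num
      have hfC : |f t| ≤ |C| * (1 + r ^ 2 - 2 * r * Real.cos (t - s)) := by
        refine (hC t ht').trans ?_
        calc _ ≤ |C| * (1 - Real.cos (t - s)) :=
              mul_le_mul_of_nonneg_right (le_abs_self C) (by linarith)
          _ ≤ _ := mul_le_mul_of_nonneg_left hA (abs_nonneg C)
      rw [div_mul_eq_mul_div, div_le_iff₀ (mul_pos hA0 (hB0.trans_le hB))]
      calc (1 + r) * (4 * r * Real.sin s * Real.sin t) * |f t|
          ≤ 8 * (|C| * (1 + r ^ 2 - 2 * r * Real.cos (t - s))) := by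
            exact mul_le_mul hnum hfC (abs_nonneg _) (by norm_num)
        _ = 32 * |C| / Real.sin s ^ 2 *
            ((1 + r ^ 2 - 2 * r * Real.cos (t - s)) * (Real.sin s ^ 2 / 4)) := by
            field_simp
            ring
        _ ≤ _ := by
            refine mul_le_mul_of_nonneg_left ?_ (by positivity)
            exact mul_le_mul_of_nonneg_left hB hA0.le
    · have hne : ∀ᵐ t : ℝ, t ≠ s := by simp [ae_iff, measure_singleton]
      filter_upwards [hne] with t hts ht
      rw [uIoc_of_le hαβ] at ht
      have hcos : Real.cos s - Real.cos t ≠ 0 := by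
        intro h
        exact hts (Real.injOn_cos ⟨by linarith [ht.1], by linarith [ht.2]⟩ ⟨hs.1.le, hs.2.le⟩
          (by linarith))
      have e : (1 + (1 : ℝ) ^ 2 - 2 * 1 * Real.cos (t - s)) *
          (1 + (1 : ℝ) ^ 2 - 2 * 1 * Real.cos (t + s)) =
          4 * (Real.cos s - Real.cos t) ^ 2 := by
        rw [Real.cos_sub, Real.cos_add]
        have e1 := Real.sin_sq_add_cos_sq t
        have e2 := Real.sin_sq_add_cos_sq s
        linear_combination (-4 * Real.sin s ^ 2) * e1 + (-4 + 4 * Real.cos t ^ 2) * e2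
      have hc : ContinuousAt (fun r : ℝ => (1 + r) * (4 * r * Real.sin s * Real.sin t) /
          ((1 + r ^ 2 - 2 * r * Real.cos (t - s)) *
            (1 + r ^ 2 - 2 * r * Real.cos (t + s))) * f t) 1 := by
        refine ContinuousAt.mul (ContinuousAt.div (by fun_prop) (by fun_prop) ?_) continuousAt_const
        rw [e]
        positivity
      have h := hc.tendsto.mono_left (nhdsWithin_le_nhds (s := Iio 1))
      simp only [e] at h
      have e3 : (1 + 1) * (4 * 1 * Real.sin s * Real.sin t) /
          (4 * (Real.cos s - Real.cos t) ^ 2) = normalKernel s t := by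
        rw [normalKernel]
        field_simp
        ring
      rw [e3] at h
      refine h.congr' ?_
      filter_upwards [hlt] with r hr
      rw [halfDiskKernel_mul_circlePoint (by linarith) hr.2]
  refine key.congr fun r => ?_
  rw [← intervalIntegral.integral_div]
  refine intervalIntegral.integral_congr fun t _ => ?_
  ring

/-- Up to the constant `2 sin s` the kernel is the product of `sin t / (cos s - cos t)`, which is
nonincreasing on `(s, π]`, and `1 / (cos s - cos t)`, which is strictly decreasing. This is the only
place where the direction of the motion of the bump matters. -/
theorem normalKernel_lt {s t₁ t₂ : ℝ} (hs : 0 < s) (h1 : s < t₁) (h12 : t₁ < t₂) (h2 : t₂ ≤ π) :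
    normalKernel s t₂ < normalKernel s t₁ := by
  have hss : 0 < Real.sin s := Real.sin_pos_of_pos_of_lt_pi hs (by linarith)
  have hs1 : 0 < Real.sin t₁ := Real.sin_pos_of_pos_of_lt_pi (by linarith) (by linarith)
  have hs2 : 0 ≤ Real.sin t₂ := Real.sin_nonneg_of_nonneg_of_le_pi (by linarith) h2
  have hD1 : 0 < Real.cos s - Real.cos t₁ :=
    sub_pos.2 (Real.cos_lt_cos_of_nonneg_of_le_pi hs.le (by linarith) h1)
  have hD12 : Real.cos s - Real.cos t₁ < Real.cos s - Real.cos t₂ :=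
    sub_lt_sub_left (Real.cos_lt_cos_of_nonneg_of_le_pi (by linarith) h2 h12) _
  have hD2 := hD1.trans hD12
  have key : Real.sin t₂ * (Real.cos s - Real.cos t₁) ≤
      Real.sin t₁ * (Real.cos s - Real.cos t₂) := by
    -- In terms of half difference `x` and half sum `y`, right side minus left side is `2 sin x (cos
    -- x - cos s cos y)`, and `|cos y| ≤ cos x`.
    obtain ⟨x, hx⟩ : ∃ x, x = (t₂ - t₁) / 2 := ⟨_, rfl⟩
    obtain ⟨y, hy⟩ : ∃ y, y = (t₁ + t₂) / 2 := ⟨_, rfl⟩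
    have e1 : t₁ = y - x := by rw [hx, hy]; ring
    have e2 : t₂ = y + x := by rw [hx, hy]; ring
    have hsx : 0 ≤ Real.sin x := Real.sin_nonneg_of_nonneg_of_le_pi (by linarith) (by linarith)
    have c1 : Real.cos y ≤ Real.cos x :=
      Real.cos_le_cos_of_nonneg_of_le_pi (by linarith) (by linarith) (by linarith)
    have c2 : -Real.cos y ≤ Real.cos x := by
      rw [← Real.cos_pi_sub]
      exact Real.cos_le_cos_of_nonneg_of_le_pi (by linarith) (by linarith) (by linarith)
    have c3 : Real.cos s * Real.cos y ≤ Real.cos x := by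
      calc _ ≤ |Real.cos s * Real.cos y| := le_abs_self _
        _ ≤ 1 * |Real.cos y| := by
          rw [abs_mul]; exact mul_le_mul_of_nonneg_right (Real.abs_cos_le_one s) (abs_nonneg _)
        _ ≤ Real.cos x := by rw [one_mul]; exact abs_le.2 ⟨by linarith, c1⟩
    have e3 : Real.sin t₁ * (Real.cos s - Real.cos t₂) - Real.sin t₂ * (Real.cos s - Real.cos t₁)
        = 2 * Real.sin x * (Real.cos x - Real.cos s * Real.cos y) := by
      rw [e1, e2, Real.sin_sub, Real.sin_add, Real.cos_sub, Real.cos_add]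
      linear_combination (2 * Real.sin x * Real.cos x) * Real.sin_sq_add_cos_sq y
    nlinarith [mul_nonneg hsx (sub_nonneg.2 c3)]
  rw [normalKernel, normalKernel, div_lt_div_iff₀ (by positivity) (by positivity)]
  have k1 : Real.sin t₂ * (Real.cos s - Real.cos t₁) ^ 2 <
      Real.sin t₁ * (Real.cos s - Real.cos t₂) ^ 2 := by
    calc _ = Real.sin t₂ * (Real.cos s - Real.cos t₁) * (Real.cos s - Real.cos t₁) := by ring
      _ ≤ Real.sin t₁ * (Real.cos s - Real.cos t₂) * (Real.cos s - Real.cos t₁) :=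
        mul_le_mul_of_nonneg_right key hD1.le
      _ < Real.sin t₁ * (Real.cos s - Real.cos t₂) * (Real.cos s - Real.cos t₂) :=
        mul_lt_mul_of_pos_left hD12 (by positivity)
      _ = _ := by ring
  nlinarith

theorem continuousOn_normalKernel {s : ℝ} (hs : 0 ≤ s) :
    ContinuousOn (normalKernel s) (Ioc s π) := by
  unfold normalKernel
  refine ContinuousOn.div (by fun_prop) (by fun_prop) fun t ht => ?_
  have := Real.cos_lt_cos_of_nonneg_of_le_pi hs ht.2 ht.1
  exact pow_ne_zero _ (sub_pos.2 this).ne'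

/-! ### Geometry of the domain -/

section

variable {a : ℝ}

theorem cos_tangentAngle (ha : 1 < a) : Real.cos (tangentAngle a) = 1 / a := by
  have h0 : 0 < a := by linarith
  exact Real.cos_arccos (le_trans (by norm_num) (by positivity : (0 : ℝ) ≤ 1 / a))
    ((div_le_one h0).2 ha.le)

theorem mul_cos_tangentAngle (ha : 1 < a) : a * Real.cos (tangentAngle a) = 1 := by
  rw [cos_tangentAngle ha]
  field_simp

theorem sin_tangentAngle_pos (ha : 1 < a) : 0 < Real.sin (tangentAngle a) := by
  obtain ⟨h1, h2⟩ := tangentAngle_mem ha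
  exact Real.sin_pos_of_pos_of_lt_pi h1 (by linarith)

theorem cos_tangentAngle_pos (ha : 1 < a) : 0 < Real.cos (tangentAngle a) := by
  rw [cos_tangentAngle ha]
  have : 0 < a := by linarith
  positivity

theorem convex_upperHalfDisk : Convex ℝ upperHalfDisk := by
  have : upperHalfDisk = closedBall (0 : ℂ) 1 ∩ {z | 0 ≤ z.im} := by
    ext z; simp [upperHalfDisk]
  rw [this]
  exact (convex_closedBall _ _).inter (convex_halfSpace_im_ge 0)

theorem convex_domain (a : ℝ) : Convex ℝ (domain a) := convex_convexHull ℝ _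

theorem upperHalfDisk_subset_domain (a : ℝ) : upperHalfDisk ⊆ domain a :=
  (subset_insert _ _).trans (subset_convexHull ℝ _)

theorem coe_mem_domain (a : ℝ) : (a : ℂ) ∈ domain a := subset_convexHull ℝ _ (mem_insert _ _)

theorem domain_eq_image (a : ℝ) :
    domain a = (fun p : ℝ × ℂ => (1 - p.1 : ℝ) • (a : ℂ) + p.1 • p.2) ''
      (Icc 0 1 ×ˢ upperHalfDisk) := by
  have hne : upperHalfDisk.Nonempty := ⟨0, by simp [upperHalfDisk]⟩
  ext z
  rw [domain, convexHull_insert hne, convex_upperHalfDisk.convexHull_eq, mem_convexJoin]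
  simp only [mem_singleton_iff, exists_eq_left, segment_eq_image, mem_image, Prod.exists, mem_prod]
  constructor
  · rintro ⟨w, hw, l, hl, rfl⟩
    exact ⟨l, w, ⟨hl, hw⟩, rfl⟩
  · rintro ⟨l, w, ⟨hl, hw⟩, rfl⟩
    exact ⟨w, hw, l, hl, rfl⟩

theorem isCompact_domain (a : ℝ) : IsCompact (domain a) := by
  rw [domain_eq_image]
  exact (isCompact_Icc.prod isCompact_upperHalfDisk).image (by fun_prop)

theorem exists_of_mem_domain {z : ℂ} (hz : z ∈ domain a) : ∃ l ∈ Icc (0 : ℝ) 1,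
    ∃ w ∈ upperHalfDisk, z.re = (1 - l) * a + l * w.re ∧ z.im = l * w.im := by
  rw [domain_eq_image] at hz
  obtain ⟨⟨l, w⟩, ⟨hl, hw⟩, rfl⟩ := hz
  exact ⟨l, hl, w, hw, by simp, by simp⟩

theorem im_nonneg_of_mem_domain {z : ℂ} (hz : z ∈ domain a) : 0 ≤ z.im := by
  obtain ⟨l, hl, w, hw, -, h⟩ := exists_of_mem_domain hz
  rw [h]
  exact mul_nonneg hl.1 hw.2

theorem re_sq_add_im_sq (z : ℂ) : z.re ^ 2 + z.im ^ 2 = ‖z‖ ^ 2 := by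
  rw [Complex.sq_norm, Complex.normSq_apply]
  ring

theorem re_mul_cos_add_im_mul_sin_le_norm (z : ℂ) (t : ℝ) :
    z.re * Real.cos t + z.im * Real.sin t ≤ ‖z‖ := by
  refine le_of_sq_le_sq ?_ (norm_nonneg z)
  rw [← re_sq_add_im_sq]
  nlinarith [sq_nonneg (z.re * Real.sin t - z.im * Real.cos t), Real.sin_sq_add_cos_sq t]

/-- The tangent to the circle at `e^{it}` supports `K` exactly as long as `a` is on its inner side,
that is `a cos t ≤ 1`, which holds from the tangency angle on. -/
theorem support_le {z : ℂ} (ha : 1 < a) (hz : z ∈ domain a) {t : ℝ}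
    (ht : t ∈ Icc (tangentAngle a) π) : z.re * Real.cos t + z.im * Real.sin t ≤ 1 := by
  obtain ⟨l, hl, w, hw, h1, h2⟩ := exists_of_mem_domain hz
  have h3 := (re_mul_cos_add_im_mul_sin_le_norm w t).trans hw.1
  have h4 : Real.cos t ≤ Real.cos (tangentAngle a) :=
    Real.cos_le_cos_of_nonneg_of_le_pi (tangentAngle_mem ha).1.le ht.2 ht.1
  have h5 : a * Real.cos t ≤ 1 := by
    rw [← mul_cos_tangentAngle ha]
    exact mul_le_mul_of_nonneg_left h4 (by linarith)
  rw [h1, h2]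
  nlinarith [mul_le_mul_of_nonneg_left h3 hl.1,
    mul_le_mul_of_nonneg_left h5 (sub_nonneg.2 hl.2)]

theorem cos_tangentAngle_lt_re {z : ℂ} (ha : 1 < a) (hz : z ∈ domain a) (hz1 : 1 < ‖z‖) :
    Real.cos (tangentAngle a) < z.re := by
  obtain ⟨l, hl, w, hw, h1, h2⟩ := exists_of_mem_domain hz
  have hw1 : w.re ^ 2 + w.im ^ 2 ≤ 1 := by
    rw [re_sq_add_im_sq]
    have := hw.1
    nlinarith [norm_nonneg w]
  have hz2 : 1 < z.re ^ 2 + z.im ^ 2 := by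
    rw [re_sq_add_im_sq]
    nlinarith
  have hl0 : 0 ≤ l := hl.1
  -- The point lies in the disk with diameter from `0` to `a`. Otherwise the norm would increase
  -- along the segment from `z` on to `w`, giving `‖w‖ > 1`.
  have key : z.re ^ 2 + z.im ^ 2 ≤ a * z.re := by
    by_contra! hlt
    have e : z.re ^ 2 + z.im ^ 2 - a * z.re = l * (z.re * (w.re - a) + z.im * w.im) := by
      rw [h1, h2]; ring
    have h3 : 0 < z.re * (w.re - a) + z.im * w.im := by
      by_contra! h
      nlinarith
    have e2 : w.re ^ 2 + w.im ^ 2 = z.re ^ 2 + z.im ^ 2 +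
        2 * (1 - l) * (z.re * (w.re - a) + z.im * w.im) +
        (1 - l) ^ 2 * ((w.re - a) ^ 2 + w.im ^ 2) := by
      rw [h1, h2]; ring
    have h5 : 0 ≤ (1 - l) * (z.re * (w.re - a) + z.im * w.im) :=
      mul_nonneg (sub_nonneg.2 hl.2) h3.le
    have h6 : 0 ≤ (1 - l) ^ 2 * ((w.re - a) ^ 2 + w.im ^ 2) := by positivity
    linarith
  rw [cos_tangentAngle ha, div_lt_iff₀ (by linarith)]
  linarith

theorem mem_domain_of_triangle {z : ℂ} (ha : 1 < a) (h1 : 0 ≤ z.im)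
    (h2 : Real.cos (tangentAngle a) ≤ z.re)
    (h3 : z.re * Real.cos (tangentAngle a) + z.im * Real.sin (tangentAngle a) ≤ 1) :
    z ∈ domain a := by
  have hc := cos_tangentAngle_pos ha
  have hs := sin_tangentAngle_pos ha
  have hac := mul_cos_tangentAngle ha
  have hsq := Real.sin_sq_add_cos_sq (tangentAngle a)
  set c := Real.cos (tangentAngle a) with hcdef
  set s := Real.sin (tangentAngle a) with hsdef
  have hT : circlePoint (tangentAngle a) ∈ domain a :=
    upperHalfDisk_subset_domain a (circlePoint_mem_upperHalfDisk
      ⟨(tangentAngle_mem ha).1.le, by linarith [(tangentAngle_mem ha).2, Real.pi_pos]⟩)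
  have hb : (c : ℂ) ∈ domain a := by
    refine upperHalfDisk_subset_domain a ⟨?_, by simp⟩
    rw [Complex.norm_real, Real.norm_of_nonneg hc.le]
    exact Real.cos_le_one _
  -- `α` and `τ` are the barycentric coordinates of `z` at `a` and `T` in the triangle with vertices
  -- `a`, `T` and the foot `cos t₀` of `T` on the real axis.
  obtain ⟨α, hα⟩ : ∃ α, α = (z.re - c) * c / s ^ 2 := ⟨_, rfl⟩
  obtain ⟨τ, hτ⟩ : ∃ τ, τ = z.im / s := ⟨_, rfl⟩
  have h := (convex_domain a).sum_mem (t := Finset.univ)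
    (w := ![α, 1 - τ - α, τ]) (z := ![(a : ℂ), (c : ℂ), circlePoint (tangentAngle a)]) ?_ ?_ ?_
  · convert h using 1
    rw [Fin.sum_univ_three]
    have hτ' : τ * s = z.im := by rw [hτ]; field_simp
    have hα' : α * (a - c) = z.re - c := by
      have ha' : a = 1 / c := by field_simp; linarith
      have : a - c = s ^ 2 / c := by
        rw [ha']; field_simp; linarith
      rw [this, hα]
      field_simp
    apply Complex.ext
    · simp [circlePoint_re, ← hcdef]
      linarith
    · simp [circlePoint_im, ← hsdef, hτ']
  · intro i _
    fin_cases i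
    · change 0 ≤ α
      rw [hα]
      exact div_nonneg (mul_nonneg (sub_nonneg.2 h2) hc.le) (by positivity)
    · change 0 ≤ 1 - τ - α
      have : 1 - τ - α = (1 - (z.re * c + z.im * s)) / s ^ 2 := by
        rw [hτ, hα]
        field_simp
        linear_combination hsq
      rw [this]
      exact div_nonneg (sub_nonneg.2 h3) (by positivity)
    · change 0 ≤ τ
      rw [hτ]
      exact div_nonneg h1 hs.le
  · rw [Fin.sum_univ_three]
    simp
  · intro i _
    fin_cases i
    · exact coe_mem_domain a
    · exact hb
    · exact hT

theorem mem_interior_domain_of_triangle {z : ℂ} (ha : 1 < a) (h1 : 0 < z.im)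
    (h2 : Real.cos (tangentAngle a) < z.re)
    (h3 : z.re * Real.cos (tangentAngle a) + z.im * Real.sin (tangentAngle a) < 1) :
    z ∈ interior (domain a) := by
  have ho : IsOpen {z : ℂ | 0 < z.im ∧ Real.cos (tangentAngle a) < z.re ∧
      z.re * Real.cos (tangentAngle a) + z.im * Real.sin (tangentAngle a) < 1} :=
    (isOpen_lt continuous_const continuous_im).inter
      ((isOpen_lt continuous_const continuous_re).inter
        (isOpen_lt ((continuous_re.mul continuous_const).add (continuous_im.mul continuous_const))
          continuous_const))
  refine interior_maximal ?_ ho ⟨h1, h2, h3⟩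
  rintro w ⟨k1, k2, k3⟩
  exact mem_domain_of_triangle ha k1.le k2.le k3.le

theorem isOpen_upperHalfDisk_interior : IsOpen {z : ℂ | ‖z‖ < 1 ∧ 0 < z.im} :=
  (isOpen_lt continuous_norm continuous_const).inter (isOpen_lt continuous_const continuous_im)

theorem mem_interior_domain_of_norm_lt {z : ℂ} (h1 : ‖z‖ < 1) (h2 : 0 < z.im) :
    z ∈ interior (domain a) := by
  refine interior_maximal ?_ isOpen_upperHalfDisk_interior ⟨h1, h2⟩
  rintro w ⟨k1, k2⟩
  exact upperHalfDisk_subset_domain a ⟨k1.le, k2.le⟩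

theorem exists_add_mem_of_mem_interior {S : Set ℂ} {z : ℂ} (hz : z ∈ interior S) (v : ℂ) :
    ∃ ε : ℝ, 0 < ε ∧ z + ε * v ∈ S := by
  have hc : ContinuousAt (fun ε : ℝ => z + ε * v) 0 := by fun_prop
  have h : ∀ᶠ ε : ℝ in 𝓝 0, z + ε * v ∈ S :=
    hc (by simpa using mem_interior_iff_mem_nhds.1 hz)
  obtain ⟨ε, h1, h2⟩ := ((h.filter_mono nhdsWithin_le_nhds).and
    (self_mem_nhdsWithin : Ioi (0 : ℝ) ∈ 𝓝[>] 0)).exists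
  exact ⟨ε, h2, h1⟩

theorem im_pos_of_mem_interior {z : ℂ} (hz : z ∈ interior (domain a)) : 0 < z.im := by
  obtain ⟨ε, hε, h⟩ := exists_add_mem_of_mem_interior hz (-I)
  have := im_nonneg_of_mem_domain h
  simp at this
  linarith

theorem support_lt {z : ℂ} (ha : 1 < a) (hz : z ∈ interior (domain a)) {t : ℝ}
    (ht : t ∈ Icc (tangentAngle a) π) : z.re * Real.cos t + z.im * Real.sin t < 1 := by
  obtain ⟨ε, hε, h⟩ := exists_add_mem_of_mem_interior hz (circlePoint t)
  have := support_le ha h ht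
  simp only [add_re, add_im, re_mul_circlePoint, im_mul_circlePoint] at this
  nlinarith [Real.sin_sq_add_cos_sq t]

theorem mem_frontier_domain {z : ℂ} (hz : z ∈ domain a) (hz' : z ∉ interior (domain a)) :
    z ∈ frontier (domain a) :=
  ⟨subset_closure hz, hz'⟩

theorem circlePoint_mem_domain (a : ℝ) {t : ℝ} (ht : t ∈ Icc 0 π) : circlePoint t ∈ domain a :=
  upperHalfDisk_subset_domain a (circlePoint_mem_upperHalfDisk ht)

theorem tangentAngle_lt_pi (ha : 1 < a) : tangentAngle a < π := by
  have := tangentAngle_mem ha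
  linarith [this.2, Real.pi_pos]

theorem circlePoint_mem_frontier (ha : 1 < a) {t : ℝ} (ht : t ∈ Icc (tangentAngle a) π) :
    circlePoint t ∈ frontier (domain a) := by
  refine mem_frontier_domain (circlePoint_mem_domain a
    ⟨(tangentAngle_mem ha).1.le.trans ht.1, ht.2⟩) fun h => ?_
  have := support_lt ha h ht
  rw [circlePoint_re, circlePoint_im] at this
  nlinarith [Real.sin_sq_add_cos_sq t]

theorem circlePoint_mem_interior (ha : 1 < a) {s : ℝ} (hs : s ∈ Ioo 0 (tangentAngle a)) :
    circlePoint s ∈ interior (domain a) := by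
  have h1 := tangentAngle_lt_pi ha
  refine mem_interior_domain_of_triangle ha ?_ ?_ ?_
  · rw [circlePoint_im]
    exact Real.sin_pos_of_pos_of_lt_pi hs.1 (hs.2.trans h1)
  · rw [circlePoint_re]
    exact Real.cos_lt_cos_of_nonneg_of_le_pi hs.1.le h1.le hs.2
  · rw [circlePoint_re, circlePoint_im]
    have := Real.cos_lt_cos_of_nonneg_of_le_pi le_rfl
      (by linarith [hs.1] : tangentAngle a - s ≤ π) (sub_pos.2 hs.2)
    rw [Real.cos_zero, Real.cos_sub] at this
    linarith

theorem circlePoint_injOn : InjOn circlePoint (Icc 0 π) := by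
  intro s hs t ht h
  have := congrArg Complex.re h
  rw [circlePoint_re, circlePoint_re] at this
  exact Real.injOn_cos hs ht this

end

/-- The data of the Dirichlet problem: a solution `u` whose boundary values are given by a bump
that is positive inside its arc. -/
structure IsBumpSolution (a δ : ℝ) (φ : ℝ → ℝ) (θ : ℝ) (u : ℂ → ℝ) : Prop
    extends IsSolution a δ φ θ u where
  one_lt : 1 < a
  width_pos : 0 < δ
  bump_zero : φ 0 = 0
  bump_width : φ δ = 0
  bump_pos : ∀ t ∈ Ioo 0 δ, 0 < φ t
  tangentAngle_le : tangentAngle a ≤ θ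
  add_le_pi : θ + δ ≤ π

/-! ### A single solution: sign, vanishing and barrier -/

namespace IsBumpSolution

variable {a δ θ θ' : ℝ} {φ : ℝ → ℝ} {u u' : ℂ → ℝ}

theorem pos (hu : IsBumpSolution a δ φ θ u) : 0 < θ :=
  (tangentAngle_mem hu.one_lt).1.trans_le hu.tangentAngle_le

theorem eq_zero_of_forall_ne (hu : IsBumpSolution a δ φ θ u) {z : ℂ} (hz : z ∈ domain a)
    (hz' : z ∉ interior (domain a)) (h : ∀ t ∈ Ioo θ (θ + δ), z ≠ circlePoint t) : u z = 0 := by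
  by_cases harc : z ∈ arc δ θ
  · obtain ⟨t, ht, rfl⟩ := harc
    rw [hu.eq_on_arc t ht]
    rcases ht.1.eq_or_lt with rfl | h1
    · rw [sub_self, hu.bump_zero]
    rcases ht.2.eq_or_lt with rfl | h2
    · rw [add_sub_cancel_left, hu.bump_width]
    exact absurd rfl (h t ⟨h1, h2⟩)
  · exact hu.eq_zero z ⟨mem_frontier_domain hz hz', harc⟩

theorem circlePoint_eq_zero (hu : IsBumpSolution a δ φ θ u) {t : ℝ}
    (ht : t ∈ Icc (tangentAngle a) π) (ht' : t ∉ Ioo θ (θ + δ)) : u (circlePoint t) = 0 := by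
  have h0 := (tangentAngle_mem hu.one_lt).1
  have ht0 : t ∈ Icc 0 π := ⟨h0.le.trans ht.1, ht.2⟩
  refine hu.eq_zero_of_forall_ne (circlePoint_mem_domain a ht0)
    (circlePoint_mem_frontier hu.one_lt ht).2 fun r hr h => ht' ?_
  rwa [circlePoint_injOn ht0 ⟨hu.pos.le.trans hr.1.le, hr.2.le.trans hu.add_le_pi⟩ h]

/-- The open arc carrying the bump lies strictly to the left of the vertical line through `T`. -/
theorem eq_zero_of_le_re (hu : IsBumpSolution a δ φ θ u) {z : ℂ} (hz : z ∈ domain a)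
    (hz' : z ∉ interior (domain a)) (hre : Real.cos (tangentAngle a) ≤ z.re) : u z = 0 := by
  refine hu.eq_zero_of_forall_ne hz hz' ?_
  rintro t ht rfl
  rw [circlePoint_re] at hre
  have := Real.cos_lt_cos_of_nonneg_of_le_pi (tangentAngle_mem hu.one_lt).1.le
    (ht.2.le.trans hu.add_le_pi) (hu.tangentAngle_le.trans_lt ht.1)
  linarith

theorem isHalfDiskHarmonic (hu : IsBumpSolution a δ φ θ u) : IsHalfDiskHarmonic u where
  continuousOn := hu.continuousOn.mono (upperHalfDisk_subset_domain a)
  harmonic := hu.harmonic.mono fun _ hz => mem_interior_domain_of_norm_lt hz.1 hz.2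
  eq_zero z h1 h2 := by
    refine hu.eq_zero_of_forall_ne (upperHalfDisk_subset_domain a ⟨h1, h2.ge⟩)
      (fun h => (im_pos_of_mem_interior h).ne' h2) ?_
    rintro t ht rfl
    rw [circlePoint_im] at h2
    exact (Real.sin_pos_of_pos_of_lt_pi (hu.pos.trans ht.1) (ht.2.trans_le hu.add_le_pi)).ne' h2

theorem bump_nonneg (hu : IsBumpSolution a δ φ θ u) {t : ℝ} (ht : t ∈ Icc 0 δ) : 0 ≤ φ t := by
  rcases ht.1.eq_or_lt with rfl | h1
  · exact hu.bump_zero.ge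
  rcases ht.2.eq_or_lt with rfl | h2
  · exact hu.bump_width.ge
  exact (hu.bump_pos t ⟨h1, h2⟩).le

theorem nonneg (hu : IsBumpSolution a δ φ θ u) {z : ℂ} (hz : z ∈ domain a) : 0 ≤ u z := by
  refine le_of_harmonicOnNhd (isCompact_domain a) isOpen_interior interior_subset hu.continuousOn
    hu.harmonic ?_ z hz
  rintro w ⟨hw, hw'⟩
  by_cases harc : w ∈ arc δ θ
  · obtain ⟨t, ht, rfl⟩ := harc
    rw [hu.eq_on_arc t ht]
    exact hu.bump_nonneg ⟨by linarith [ht.1], by linarith [ht.2]⟩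
  · exact (hu.eq_zero w ⟨mem_frontier_domain hw hw', harc⟩).ge

/-- If the arc does not reach the tangency point, the solution is bounded by a multiple of the
distance to the tangent line. -/
theorem exists_le_mul (hu : IsBumpSolution a δ φ θ u) (hθ : tangentAngle a < θ) :
    ∃ C, ∀ z ∈ domain a, u z ≤
      C * (1 - (z.re * Real.cos (tangentAngle a) + z.im * Real.sin (tangentAngle a))) := by
  have ha := hu.one_lt
  obtain ⟨M, hM⟩ := (isCompact_domain a).bddAbove_image hu.continuousOn
  have hM' : ∀ z ∈ domain a, u z ≤ M := fun z hz => hM (mem_image_of_mem u hz)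
  have hM0 : 0 ≤ M := (hu.nonneg (coe_mem_domain a)).trans (hM' _ (coe_mem_domain a))
  have ht0 := tangentAngle_mem ha
  have hT : tangentAngle a ∈ Icc (tangentAngle a) π := ⟨le_rfl, (tangentAngle_lt_pi ha).le⟩
  have hρ : 0 < 1 - Real.cos (θ - tangentAngle a) := by
    have := Real.cos_lt_cos_of_nonneg_of_le_pi le_rfl
      (by linarith [hu.add_le_pi, hu.width_pos, ht0.1] : θ - tangentAngle a ≤ π) (sub_pos.2 hθ)
    rw [Real.cos_zero] at this
    linarith
  -- On the arc the distance to the tangent line at `T` is `1 - cos (t - t₀)`, at least its value at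
  -- `t = θ`; with this `C` the linear barrier dominates `M` there.
  set C := M / (1 - Real.cos (θ - tangentAngle a)) with hC
  have hC0 : 0 ≤ C := by positivity
  refine ⟨C, fun z hz => sub_nonneg.1 ?_⟩
  refine le_of_harmonicOnNhd (f := fun z => C * (1 - (z.re * Real.cos (tangentAngle a) +
    z.im * Real.sin (tangentAngle a))) - u z) (isCompact_domain a) isOpen_interior interior_subset
    ?_ ?_ ?_ z hz
  · refine ContinuousOn.sub (Continuous.continuousOn ?_) hu.continuousOn
    exact continuous_const.mul (continuous_const.sub ((continuous_re.mul continuous_const).add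
      (continuous_im.mul continuous_const)))
  · refine HarmonicOnNhd.sub (fun w _ => ?_) hu.harmonic
    have h := AnalyticAt.harmonicAt_re
      (f := fun z : ℂ => (C : ℂ) * (1 - z * circlePoint (-tangentAngle a))) (x := w) (by fun_prop)
    refine (harmonicAt_congr_nhds (Eventually.of_forall fun z => ?_)).1 h
    simp [circlePoint_re, circlePoint_im]
  · rintro w ⟨hw, hw'⟩
    have h1 := support_le ha hw hT
    by_cases harc : w ∈ arc δ θ
    · obtain ⟨t, ht, rfl⟩ := harc
      refine sub_nonneg.2 ((hM' _ hw).trans ?_)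
      rw [circlePoint_re, circlePoint_im, ← Real.cos_sub, hC, div_mul_eq_mul_div,
        le_div_iff₀ hρ]
      refine mul_le_mul_of_nonneg_left ?_ hM0
      have := Real.cos_le_cos_of_nonneg_of_le_pi (sub_pos.2 hθ).le
        (by linarith [ht.2, hu.add_le_pi, ht0.1] : t - tangentAngle a ≤ π) (by linarith [ht.1])
      linarith
    · rw [hu.eq_zero w ⟨mem_frontier_domain hw hw', harc⟩, sub_zero]
      exact mul_nonneg hC0 (by linarith)

theorem exists_circlePoint_le_mul (hu : IsBumpSolution a δ φ θ u) (hθ : tangentAngle a < θ) :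
    ∃ C, ∀ t ∈ Icc 0 π, |u (circlePoint t)| ≤ C * (1 - Real.cos (t - tangentAngle a)) := by
  obtain ⟨C, hC⟩ := hu.exists_le_mul hθ
  refine ⟨C, fun t ht => ?_⟩
  have h := circlePoint_mem_domain a ht
  rw [abs_of_nonneg (hu.nonneg h)]
  have := hC _ h
  rwa [circlePoint_re, circlePoint_im, ← Real.cos_sub] at this

theorem continuousOn_bump (hu : IsBumpSolution a δ φ θ u) : ContinuousOn φ (Icc 0 δ) := by
  have h : ContinuousOn (fun t => u (circlePoint (θ + t))) (Icc 0 δ) := by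
    refine hu.continuousOn.comp
      (continuous_circlePoint.comp (continuous_const.add continuous_id)).continuousOn fun t ht => ?_
    exact circlePoint_mem_domain a
      ⟨by linarith [hu.pos, ht.1], by linarith [hu.add_le_pi, ht.2]⟩
  refine h.congr fun t ht => ?_
  simp only
  rw [hu.eq_on_arc (θ + t) ⟨by linarith [ht.1], by linarith [ht.2]⟩, add_sub_cancel_left]

/-- Translating the variable puts the dependence on `θ` into the kernel and leaves the fixed bump
`φ`, so different positions can be compared pointwise. -/
theorem normalKernel_integral (hu : IsBumpSolution a δ φ θ u) {s : ℝ} (hs : 0 < s) (hsθ : s < θ) :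
    IntervalIntegrable (fun t => normalKernel s t * u (circlePoint t)) volume (tangentAngle a) π ∧
    ∫ t in (tangentAngle a)..π, normalKernel s t * u (circlePoint t) =
      ∫ t in (0 : ℝ)..δ, normalKernel s (t + θ) * φ t := by
  have h0 := hu.tangentAngle_le
  have h1 := hu.width_pos
  have h2 := hu.add_le_pi
  have ht0 := (tangentAngle_mem hu.one_lt).1
  have z1 : ∀ t ∈ Icc (tangentAngle a) θ, normalKernel s t * u (circlePoint t) = 0 := by
    intro t ht
    rw [hu.circlePoint_eq_zero ⟨ht.1, by linarith [ht.2]⟩ (fun h => not_lt.2 ht.2 h.1), mul_zero]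
  have z2 : ∀ t ∈ Icc (θ + δ) π, normalKernel s t * u (circlePoint t) = 0 := by
    intro t ht
    rw [hu.circlePoint_eq_zero ⟨by linarith [ht.1], ht.2⟩ (fun h => not_lt.2 ht.1 h.2), mul_zero]
  have i1 : IntervalIntegrable (fun t => normalKernel s t * u (circlePoint t)) volume
      (tangentAngle a) θ :=
    (continuousOn_const.congr z1).intervalIntegrable_of_Icc h0
  have i3 : IntervalIntegrable (fun t => normalKernel s t * u (circlePoint t)) volume (θ + δ) π :=
    (continuousOn_const.congr z2).intervalIntegrable_of_Icc h2
  have i2 : IntervalIntegrable (fun t => normalKernel s t * u (circlePoint t)) volume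
      θ (θ + δ) := by
    refine ContinuousOn.intervalIntegrable_of_Icc (by linarith) (ContinuousOn.mul ?_ ?_)
    · exact (continuousOn_normalKernel hs.le).mono fun t ht =>
        ⟨by linarith [ht.1], by linarith [ht.2]⟩
    · exact hu.isHalfDiskHarmonic.continuousOn_circlePoint.mono fun t ht =>
        ⟨by linarith [ht.1], by linarith [ht.2]⟩
  refine ⟨(i1.trans i2).trans i3, ?_⟩
  rw [← intervalIntegral.integral_add_adjacent_intervals (i1.trans i2) i3,
    ← intervalIntegral.integral_add_adjacent_intervals i1 i2]
  have e1 : ∫ t in (tangentAngle a)..θ, normalKernel s t * u (circlePoint t) = 0 := by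
    rw [intervalIntegral.integral_congr (g := fun _ => 0), intervalIntegral.integral_zero]
    intro t ht
    rw [uIcc_of_le h0] at ht
    exact z1 t ht
  have e3 : ∫ t in (θ + δ)..π, normalKernel s t * u (circlePoint t) = 0 := by
    rw [intervalIntegral.integral_congr (g := fun _ => 0), intervalIntegral.integral_zero]
    intro t ht
    rw [uIcc_of_le h2] at ht
    exact z2 t ht
  have e2 := intervalIntegral.integral_comp_add_right (a := 0) (b := δ)
    (fun t => normalKernel s t * u (circlePoint t)) θ
  rw [zero_add, add_comm δ] at e2
  rw [e1, e3, zero_add, add_zero, ← e2]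
  refine intervalIntegral.integral_congr fun t ht => ?_
  rw [uIcc_of_le h1.le] at ht
  rw [hu.eq_on_arc (t + θ) ⟨by linarith [ht.1], by linarith [ht.2]⟩, add_sub_cancel_right]

/-! ### Comparison of the two solutions in the cap -/

theorem integral_normalKernel_pos (hu : IsBumpSolution a δ φ θ u)
    (hu' : IsBumpSolution a δ φ θ' u') (hθ : θ < θ') {s : ℝ} (hs : 0 < s) (hsθ : s < θ) :
    0 < ∫ t in (tangentAngle a)..π, normalKernel s t * (u (circlePoint t) - u' (circlePoint t)) := by
  obtain ⟨i1, e1⟩ := hu.normalKernel_integral hs hsθ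
  obtain ⟨i2, e2⟩ := hu'.normalKernel_integral hs (hsθ.trans hθ)
  have hδ := hu.width_pos
  simp only [mul_sub]
  rw [intervalIntegral.integral_sub i1 i2, e1, e2]
  have hc : ∀ {θ₀ : ℝ}, s < θ₀ → θ₀ + δ ≤ π → IntervalIntegrable
      (fun t => normalKernel s (t + θ₀) * φ t) volume 0 δ := by
    intro θ₀ h1 h2
    refine ContinuousOn.intervalIntegrable_of_Icc hδ.le (ContinuousOn.mul ?_ hu.continuousOn_bump)
    exact (continuousOn_normalKernel hs.le).comp
      (continuous_id.add continuous_const).continuousOn fun t ht =>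
        ⟨by linarith [ht.1], by linarith [ht.2]⟩
  have j1 := hc hsθ hu.add_le_pi
  have j2 := hc (hsθ.trans hθ) hu'.add_le_pi
  rw [← intervalIntegral.integral_sub j1 j2]
  refine intervalIntegral.intervalIntegral_pos_of_pos_on (j1.sub j2) (fun t ht => ?_) hδ
  rw [← sub_mul]
  refine mul_pos (sub_pos.2 (normalKernel_lt hs ?_ ?_ ?_)) (hu.bump_pos t ht)
  · linarith [ht.1]
  · linarith
  · linarith [ht.2, hu'.add_le_pi]

/-- For `s < t₀` the factor `1 - cos (t - s)` stays away from zero on `[t₀, π]` and boundedness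
suffices; for `s = t₀` the barrier at the tangent line is needed. -/
theorem exists_abs_sub_le (hu : IsBumpSolution a δ φ θ u)
    (hu' : IsBumpSolution a δ φ θ' u') (hθ : θ < θ') {s : ℝ} (hs : 0 < s)
    (hst : s ≤ tangentAngle a) (hsθ : s < θ) :
    ∃ C, ∀ t ∈ Icc (tangentAngle a) π,
      |u (circlePoint t) - u' (circlePoint t)| ≤ C * (1 - Real.cos (t - s)) := by
  have ha := hu.one_lt
  have ht0 := (tangentAngle_mem ha).1
  have htp := tangentAngle_lt_pi ha
  rcases hst.eq_or_lt with rfl | hlt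
  · obtain ⟨C, hC⟩ := hu.exists_circlePoint_le_mul hsθ
    obtain ⟨C', hC'⟩ := hu'.exists_circlePoint_le_mul (hsθ.trans hθ)
    refine ⟨C + C', fun t ht => ?_⟩
    have h : t ∈ Icc 0 π := ⟨ht0.le.trans ht.1, ht.2⟩
    rw [add_mul]
    exact (abs_sub _ _).trans (add_le_add (hC t h) (hC' t h))
  · obtain ⟨M, hM⟩ := isCompact_Icc.exists_bound_of_continuousOn
      (hu.isHalfDiskHarmonic.continuousOn_circlePoint.sub
        hu'.isHalfDiskHarmonic.continuousOn_circlePoint)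
    have hρ : 0 < 1 - Real.cos (tangentAngle a - s) := by
      have := Real.cos_lt_cos_of_nonneg_of_le_pi le_rfl
        (by linarith : tangentAngle a - s ≤ π) (sub_pos.2 hlt)
      rw [Real.cos_zero] at this
      linarith
    refine ⟨M / (1 - Real.cos (tangentAngle a - s)), fun t ht => ?_⟩
    have hMt := hM t ⟨ht0.le.trans ht.1, ht.2⟩
    refine le_trans hMt ?_
    rw [div_mul_eq_mul_div, le_div_iff₀ hρ]
    refine mul_le_mul_of_nonneg_left ?_ ((norm_nonneg _).trans hMt)
    have := Real.cos_le_cos_of_nonneg_of_le_pi (sub_pos.2 hlt).le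
      (by linarith [ht.2] : t - s ≤ π) (by linarith [ht.1])
    linarith

/-- Lower bound for the growth of `u - u'` along a radius that ends on the arc of the half disk
facing the point `a`. -/
theorem exists_mul_le_sub (hu : IsBumpSolution a δ φ θ u)
    (hu' : IsBumpSolution a δ φ θ' u') (hθ : θ < θ') {s m : ℝ} (hs : 0 < s)
    (hst : s ≤ tangentAngle a) (hsθ : s < θ) (hm : m ≤ 0)
    (hle : ∀ t ∈ Icc 0 (tangentAngle a), m ≤ u (circlePoint t) - u' (circlePoint t)) :
    ∃ c, 0 < c ∧ ∀ᶠ r : ℝ in 𝓝[<] 1,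
      c * (1 - r) ≤ u (r * circlePoint s) - u' (r * circlePoint s) - m := by
  have ha := hu.one_lt
  have ht0 := (tangentAngle_mem ha).1
  have htp := tangentAngle_lt_pi ha
  have hpi := Real.pi_pos
  have hw := hu.isHalfDiskHarmonic.sub hu'.isHalfDiskHarmonic
  obtain ⟨C, hC⟩ := hu.exists_abs_sub_le hu' hθ hs hst hsθ
  have hJ := hu.integral_normalKernel_pos hu' hθ hs hsθ
  have hlim := tendsto_integral_halfDiskKernel (s := s) ⟨hs, by linarith⟩ ht0.le htp.le le_rfl
    (hw.continuousOn_circlePoint.mono (Icc_subset_Icc_left ht0.le)) hC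
  set J := ∫ t in (tangentAngle a)..π,
    normalKernel s t * (u (circlePoint t) - u' (circlePoint t)) with hJdef
  -- The Poisson formula divides by `2 * π`, and near `r = 1` at least half of the limit `J` is
  -- available.
  refine ⟨J / (4 * π), by positivity, ?_⟩
  have hlt : ∀ᶠ r : ℝ in 𝓝[<] 1, 0 < r ∧ r < 1 := Ioo_mem_nhdsLT (by norm_num : (0 : ℝ) < 1)
  filter_upwards [hlt, hlim.eventually_const_lt (half_lt_self hJ)] with r hr hrJ
  have hz : ‖(r : ℂ) * circlePoint s‖ < 1 := by rw [norm_mul_circlePoint hr.1.le]; exact hr.2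
  have hz' : 0 ≤ ((r : ℂ) * circlePoint s).im := by
    rw [im_mul_circlePoint]
    exact mul_nonneg hr.1.le (Real.sin_nonneg_of_nonneg_of_le_pi hs.le (by linarith))
  have hform := hw.integral_halfDiskKernel hz hz'
  have hQ := continuous_halfDiskKernel hz
  have hi := hw.intervalIntegrable hz
  have sub1 : uIcc 0 (tangentAngle a) ⊆ uIcc 0 π := by
    rw [uIcc_of_le ht0.le, uIcc_of_le hpi.le]; exact Icc_subset_Icc_right htp.le
  have sub2 : uIcc (tangentAngle a) π ⊆ uIcc 0 π := by
    rw [uIcc_of_le htp.le, uIcc_of_le hpi.le]; exact Icc_subset_Icc_left ht0.le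
  have hi1 := hi.mono_set sub1
  have hi2 := hi.mono_set sub2
  rw [← intervalIntegral.integral_add_adjacent_intervals hi1 hi2] at hform
  have hQle : ∫ t in (0 : ℝ)..tangentAngle a, halfDiskKernel (r * circlePoint s) t ≤ 2 * π := by
    refine le_trans ?_ (integral_halfDiskKernel_le hz)
    rw [← intervalIntegral.integral_add_adjacent_intervals (b := tangentAngle a) (c := π)
      (hQ.intervalIntegrable _ _) (hQ.intervalIntegrable _ _)]
    have : 0 ≤ ∫ t in (tangentAngle a)..π, halfDiskKernel (r * circlePoint s) t :=
      intervalIntegral.integral_nonneg htp.le fun t ht =>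
        halfDiskKernel_nonneg hz hz' ⟨ht0.le.trans ht.1, ht.2⟩
    linarith
  -- As `m ≤ 0`, the upper bound on the kernel mass of the arc is what gives a lower bound for its
  -- contribution.
  have h1 : 2 * π * m ≤ ∫ t in (0 : ℝ)..tangentAngle a, halfDiskKernel (r * circlePoint s) t *
      (u (circlePoint t) - u' (circlePoint t)) := by
    calc 2 * π * m ≤ (∫ t in (0 : ℝ)..tangentAngle a, halfDiskKernel (r * circlePoint s) t) * m :=
          mul_le_mul_of_nonpos_right hQle hm
      _ = ∫ t in (0 : ℝ)..tangentAngle a, halfDiskKernel (r * circlePoint s) t * m :=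
          (intervalIntegral.integral_mul_const _ _).symm
      _ ≤ _ := by
          refine intervalIntegral.integral_mono_on ht0.le
            ((hQ.mul continuous_const).intervalIntegrable _ _) hi1 fun t ht => ?_
          exact mul_le_mul_of_nonneg_left (hle t ht)
            (halfDiskKernel_nonneg hz hz' ⟨ht.1, ht.2.trans htp.le⟩)
  rw [lt_div_iff₀ (by linarith [hr.2])] at hrJ
  rw [div_mul_eq_mul_div, div_le_iff₀ (by positivity)]
  linarith

end IsBumpSolution

theorem mem_interior_domain_of_mem_interior_halfCap {a : ℝ} (ha : 1 < a) {z : ℂ}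
    (hz : z ∈ interior (halfCap a)) :
    z ∈ interior (domain a) ∧ 1 < ‖z‖ ∧ Real.cos (tangentAngle a) < z.re := by
  have h1 : z ∈ interior (domain a) := interior_mono sdiff_subset hz
  have h2 : 1 < ‖z‖ := by
    by_contra! h
    exact (interior_subset hz).2 ⟨h, (im_pos_of_mem_interior h1).le⟩
  exact ⟨h1, h2, cos_tangentAngle_lt_re ha (interior_subset h1) h2⟩

namespace IsBumpSolution

variable {a δ θ θ' : ℝ} {φ : ℝ → ℝ} {u u' : ℂ → ℝ}

/-- On the closed cap the difference of the solutions is bounded below by its values on the arc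
that separates the cap from the half disk. -/
theorem le_sub_of_le_on_arc (hu : IsBumpSolution a δ φ θ u)
    (hu' : IsBumpSolution a δ φ θ' u') {m : ℝ}
    (hle : ∀ t ∈ Icc 0 (tangentAngle a), m ≤ u (circlePoint t) - u' (circlePoint t)) {z : ℂ}
    (hz : z ∈ domain a) (hz1 : 1 ≤ ‖z‖) (hzre : Real.cos (tangentAngle a) ≤ z.re) :
    m ≤ u z - u' z := by
  have ha := hu.one_lt
  have ht0 := (tangentAngle_mem ha).1
  have htp := tangentAngle_lt_pi ha
  -- The arc includes its endpoint `T`, where both solutions vanish.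
  have hm : m ≤ 0 := by
    have h := hle _ ⟨ht0.le, le_rfl⟩
    rwa [hu.circlePoint_eq_zero ⟨le_rfl, htp.le⟩ fun h => not_lt.2 hu.tangentAngle_le h.1,
      hu'.circlePoint_eq_zero ⟨le_rfl, htp.le⟩ fun h => not_lt.2 hu'.tangentAngle_le h.1,
      sub_zero] at h
  -- The half plane condition removes the part of the unit circle to the left of `T`, where the
  -- bumps sit; it holds automatically at points of `K` with norm above `1`.
  have hS : IsCompact (domain a ∩ ({z | 1 ≤ ‖z‖} ∩ {z | Real.cos (tangentAngle a) ≤ z.re})) :=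
    (isCompact_domain a).inter_right ((isClosed_le continuous_const continuous_norm).inter
      (isClosed_le continuous_const continuous_re))
  have hU : IsOpen (interior (domain a) ∩
      ({z | 1 < ‖z‖} ∩ {z | Real.cos (tangentAngle a) < z.re})) :=
    isOpen_interior.inter ((isOpen_lt continuous_const continuous_norm).inter
      (isOpen_lt continuous_const continuous_re))
  refine le_of_harmonicOnNhd (f := fun z => u z - u' z) hS hU ?_ ?_ ?_ ?_ z ⟨hz, hz1, hzre⟩
  · exact fun w hw => ⟨interior_subset hw.1, (le_of_lt hw.2.1 : 1 ≤ ‖w‖), (le_of_lt hw.2.2 : _ ≤ w.re)⟩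
  · exact (hu.continuousOn.sub hu'.continuousOn).mono inter_subset_left
  · exact (hu.harmonic.sub hu'.harmonic).mono inter_subset_left
  · rintro w ⟨⟨hw, hw1, hwre⟩, hwU⟩
    by_cases hwi : w ∈ interior (domain a)
    · have hw1' : ‖w‖ = 1 := by
        refine le_antisymm (not_lt.1 fun h => ?_) hw1
        exact hwU ⟨hwi, h, cos_tangentAngle_lt_re ha hw h⟩
      have him := im_nonneg_of_mem_domain hw
      rw [exists_circlePoint_eq hw1' him]
      refine hle _ ⟨Real.arccos_nonneg _, ?_⟩
      rw [← Real.arccos_cos ht0.le htp.le]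
      exact Real.arccos_le_arccos hwre
    · rw [hu.eq_zero_of_le_re hw hwi hwre, hu'.eq_zero_of_le_re hw hwi hwre, sub_zero]
      exact hm

/-- At a negative minimum inside the arc, the radial derivative would be nonnegative by the minimum
principle in the cap and at most `-c` by the Poisson estimate in the half disk. It exists because
the point is interior to `K`. -/
theorem sub_nonneg_on_arc (hu : IsBumpSolution a δ φ θ u)
    (hu' : IsBumpSolution a δ φ θ' u') (hθ : θ < θ') {t : ℝ}
    (ht : t ∈ Icc 0 (tangentAngle a)) : 0 ≤ u (circlePoint t) - u' (circlePoint t) := by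
  have ha := hu.one_lt
  have ht0 := (tangentAngle_mem ha).1
  have htp := tangentAngle_lt_pi ha
  have hcont : ContinuousOn (fun t => u (circlePoint t) - u' (circlePoint t))
      (Icc 0 (tangentAngle a)) :=
    (hu.isHalfDiskHarmonic.sub hu'.isHalfDiskHarmonic).continuousOn_circlePoint.mono
      (Icc_subset_Icc_right htp.le)
  obtain ⟨s, hs, hmin⟩ := isCompact_Icc.exists_isMinOn ⟨t, ht⟩ hcont
  have hle : ∀ t ∈ Icc 0 (tangentAngle a),
      u (circlePoint s) - u' (circlePoint s) ≤ u (circlePoint t) - u' (circlePoint t) := hmin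
  refine le_trans ?_ (hle t ht)
  by_contra! hneg
  obtain ⟨m, hm⟩ : ∃ m, m = u (circlePoint s) - u' (circlePoint s) := ⟨_, rfl⟩
  rw [← hm] at hneg hle
  have hs0 : 0 < s := by
    refine hs.1.lt_of_ne fun h => ?_
    have h1 : ‖circlePoint s‖ ≤ 1 := (norm_circlePoint s).le
    have h2 : (circlePoint s).im = 0 := by rw [circlePoint_im, ← h, Real.sin_zero]
    rw [hm, hu.isHalfDiskHarmonic.eq_zero _ h1 h2, hu'.isHalfDiskHarmonic.eq_zero _ h1 h2] at hneg
    linarith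
  have hst : s < tangentAngle a := by
    refine hs.2.lt_of_ne fun h => ?_
    rw [hm, h, hu.circlePoint_eq_zero ⟨le_rfl, htp.le⟩ fun h => not_lt.2 hu.tangentAngle_le h.1,
      hu'.circlePoint_eq_zero ⟨le_rfl, htp.le⟩ fun h => not_lt.2 hu'.tangentAngle_le h.1] at hneg
    linarith
  obtain ⟨c, hc, hev⟩ := hu.exists_mul_le_sub hu' hθ hs0 hst.le (hst.trans_le hu.tangentAngle_le)
    hneg.le hle
  have hint := circlePoint_mem_interior ha ⟨hs0, hst⟩
  set q : ℝ → ℝ := fun r => u (r * circlePoint s) - u' (r * circlePoint s) with hq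
  have hq1 : q 1 = m := by simp [hq, hm]
  have hd : DifferentiableAt ℝ q 1 := by
    have hl : DifferentiableAt ℝ (fun r : ℝ => (r : ℂ) * circlePoint s) 1 :=
      Complex.ofRealCLM.differentiableAt.mul_const _
    have h1 : DifferentiableAt ℝ (fun z => u z - u' z) (((1 : ℝ) : ℂ) * circlePoint s) := by
      rw [Complex.ofReal_one, one_mul]
      exact ((hu.harmonic.sub hu'.harmonic) _ hint).1.differentiableAt (by norm_num)
    exact h1.comp (1 : ℝ) hl
  have hslope := hasDerivAt_iff_tendsto_slope.1 hd.hasDerivAt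
  have hright : 0 ≤ deriv q 1 := by
    have h1 : Tendsto (slope q 1) (𝓝[>] 1) (𝓝 (deriv q 1)) :=
      hslope.mono_left (nhdsWithin_mono _ fun x hx => ne_of_gt hx)
    have hcr : ContinuousAt (fun r : ℝ => (r : ℂ) * circlePoint s) 1 := by fun_prop
    have h2 : ∀ᶠ r : ℝ in 𝓝 1, (r : ℂ) * circlePoint s ∈ interior (domain a) :=
      hcr (by simpa using isOpen_interior.mem_nhds hint)
    refine ge_of_tendsto h1 ?_
    filter_upwards [self_mem_nhdsWithin, h2.filter_mono nhdsWithin_le_nhds] with r hr hri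
    have hr' : 1 < r := hr
    have hn : 1 < ‖(r : ℂ) * circlePoint s‖ := by
      rw [norm_mul_circlePoint (by linarith)]; exact hr'
    have h3 := hu.le_sub_of_le_on_arc hu' hle (interior_subset hri) hn.le
      (cos_tangentAngle_lt_re ha (interior_subset hri) hn).le
    rw [slope_def_field, hq1]
    exact div_nonneg (sub_nonneg.2 h3) (by linarith)
  have hleft : deriv q 1 ≤ -c := by
    have h1 : Tendsto (slope q 1) (𝓝[<] 1) (𝓝 (deriv q 1)) :=
      hslope.mono_left (nhdsWithin_mono _ fun x hx => ne_of_lt hx)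
    refine le_of_tendsto h1 ?_
    filter_upwards [self_mem_nhdsWithin, hev] with r hr hre
    have hr' : r < 1 := hr
    rw [slope_def_field, hq1, div_le_iff_of_neg (by linarith)]
    linarith
  linarith

theorem sub_nonneg_of_one_le_norm (hu : IsBumpSolution a δ φ θ u)
    (hu' : IsBumpSolution a δ φ θ' u') (hθ : θ < θ') {z : ℂ}
    (hz : z ∈ domain a) (hz1 : 1 ≤ ‖z‖) (hzre : Real.cos (tangentAngle a) ≤ z.re) :
    0 ≤ u z - u' z :=
  hu.le_sub_of_le_on_arc hu' (fun _ ht => hu.sub_nonneg_on_arc hu' hθ ht) hz hz1 hzre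

/-- Just after `θ` and before `θ'` there are boundary points where `u` is positive and `u'`
vanishes; continuity along a radius excludes equality inside. -/
theorem not_eqOn_interior (hu : IsBumpSolution a δ φ θ u)
    (hu' : IsBumpSolution a δ φ θ' u') (hθ : θ < θ') :
    ¬ EqOn (fun z => u z - u' z) 0 (interior (domain a)) := by
  intro heq
  have hδ := hu.width_pos
  have hpos := hu.pos
  obtain ⟨t, ht1, ht2⟩ := exists_between (lt_min (by linarith : θ < θ + δ) hθ)
  rw [lt_min_iff] at ht2
  have htpi : t < π := ht2.1.trans_le hu.add_le_pi
  have htd : circlePoint t ∈ domain a := circlePoint_mem_domain a ⟨by linarith, htpi.le⟩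
  have h1 : 0 < u (circlePoint t) := by
    rw [hu.eq_on_arc t ⟨ht1.le, ht2.1.le⟩]
    exact hu.bump_pos _ ⟨by linarith, by linarith [ht2.1]⟩
  have h2 : u' (circlePoint t) = 0 :=
    hu'.circlePoint_eq_zero ⟨hu.tangentAngle_le.trans ht1.le, htpi.le⟩
      fun h => not_lt.2 ht2.2.le h.1
  have hlt : ∀ᶠ r : ℝ in 𝓝[<] 1, 0 < r ∧ r < 1 := Ioo_mem_nhdsLT (by norm_num : (0 : ℝ) < 1)
  have hin : ∀ᶠ r : ℝ in 𝓝[<] 1, (r : ℂ) * circlePoint t ∈ interior (domain a) := by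
    filter_upwards [hlt] with r hr
    refine mem_interior_domain_of_norm_lt ?_ ?_
    · rw [norm_mul_circlePoint hr.1.le]; exact hr.2
    · rw [im_mul_circlePoint]
      exact mul_pos hr.1 (Real.sin_pos_of_pos_of_lt_pi (by linarith) htpi)
  have hcr : Tendsto (fun r : ℝ => (r : ℂ) * circlePoint t) (𝓝[<] 1)
      (𝓝[domain a] (circlePoint t)) := by
    refine tendsto_nhdsWithin_iff.2 ⟨?_, hin.mono fun r hr => interior_subset hr⟩
    have : ContinuousAt (fun r : ℝ => (r : ℂ) * circlePoint t) 1 := by fun_prop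
    simpa using this.tendsto.mono_left nhdsWithin_le_nhds
  have hlim := ((hu.continuousOn.sub hu'.continuousOn) _ htd).tendsto.comp hcr
  have h0 : Tendsto (fun _ : ℝ => (0 : ℝ)) (𝓝[<] 1) (𝓝 (u (circlePoint t) - u' (circlePoint t))) :=
    hlim.congr' (hin.mono fun r hr => heq hr)
  have := tendsto_nhds_unique h0 tendsto_const_nhds
  linarith

/-- A zero of the nonnegative difference would be a local minimum, hence a point of local constancy;
real analyticity on the convex, so connected, interior of `K` spreads the zero everywhere. -/
theorem lt_of_one_lt_norm (hu : IsBumpSolution a δ φ θ u)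
    (hu' : IsBumpSolution a δ φ θ' u') (hθ : θ < θ') {z : ℂ}
    (hz : z ∈ interior (domain a)) (hz1 : 1 < ‖z‖) : u' z < u z := by
  have ha := hu.one_lt
  have hw : ∀ w ∈ interior (domain a), 1 < ‖w‖ → 0 ≤ u w - u' w := fun w hw hw1 =>
    hu.sub_nonneg_of_one_le_norm hu' hθ (interior_subset hw) hw1.le
      (cos_tangentAngle_lt_re ha (interior_subset hw) hw1).le
  have hharm := hu.harmonic.sub hu'.harmonic
  refine sub_pos.1 ((hw z hz hz1).lt_of_ne fun h0 => hu.not_eqOn_interior hu' hθ ?_)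
  have hloc : IsLocalMin (u - u') z := by
    filter_upwards [isOpen_interior.mem_nhds hz,
      (isOpen_lt continuous_const continuous_norm).mem_nhds hz1] with w hwi hw1
    simp only [Pi.sub_apply, ← h0]
    exact hw w hwi hw1
  have hev := eventually_eq_of_isLocalMin (hharm z hz) hloc
  refine AnalyticOnNhd.eqOn_zero_of_preconnected_of_eventuallyEq_zero (𝕜 := ℝ) (z₀ := z)
    (fun w hw => HarmonicAt.analyticAt (hharm w hw)) (convex_domain a).interior.isPreconnected hz ?_
  filter_upwards [hev] with w hw
  exact hw.trans h0.symm

end IsBumpSolution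

/-! ### Normal derivatives along the tangent segment -/

theorem hasOutwardNormalDeriv_of_tendsto {v : ℂ → ℝ} {n x : ℂ} {L : ℝ} (hx : v x = 0)
    (h : Tendsto (fun y : ℝ => v (x - y * n) / y) (𝓝[>] 0) (𝓝 L)) :
    HasOutwardNormalDeriv v n x (-L) := by
  rw [HasOutwardNormalDeriv, hasDerivWithinAt_iff_tendsto_slope]
  have e : Iic (0 : ℝ) \ {0} = Iio 0 := Iic_sdiff_right
  rw [e]
  have hneg : Tendsto (fun y : ℝ => -y) (𝓝[<] 0) (𝓝[>] 0) := by
    simpa using tendsto_neg_nhdsLT (a := (0 : ℝ))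
  refine (h.comp hneg).neg.congr fun y => ?_
  rw [slope_def_field]
  simp only [Function.comp_apply, ofReal_neg, ofReal_zero, zero_mul, add_zero, hx, sub_zero,
    neg_mul, sub_neg_eq_add, div_neg, neg_neg]

theorem exists_normalDeriv_sq_lt {v v' : ℂ → ℝ} {n x : ℂ} {L L' : ℝ} (hx : v x = 0)
    (hx' : v' x = 0) (h : Tendsto (fun y : ℝ => v (x - y * n) / y) (𝓝[>] 0) (𝓝 L))
    (h' : Tendsto (fun y : ℝ => v' (x - y * n) / y) (𝓝[>] 0) (𝓝 L')) (hL' : 0 ≤ L')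
    (hL : L' < L) :
    ∃ d d' : ℝ, HasOutwardNormalDeriv v n x d ∧ HasOutwardNormalDeriv v' n x d' ∧
      d' ^ 2 < d ^ 2 := by
  refine ⟨-L, -L', hasOutwardNormalDeriv_of_tendsto hx h, hasOutwardNormalDeriv_of_tendsto hx' h',
    ?_⟩
  rw [neg_sq, neg_sq]
  exact pow_lt_pow_left₀ hL hL' two_ne_zero

namespace IsBumpSolution

variable {a δ θ θ' : ℝ} {φ : ℝ → ℝ} {u u' : ℂ → ℝ}

theorem tendsto_div_tangentPoint (hu : IsBumpSolution a δ φ θ u) (hθ : tangentAngle a < θ) :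
    ∃ L, Tendsto (fun r : ℝ => u (r * tangentPoint a) / (1 - r)) (𝓝[<] 1) (𝓝 L) := by
  have ha := hu.one_lt
  have ht0 := (tangentAngle_mem ha).1
  have htp := tangentAngle_lt_pi ha
  obtain ⟨C, hC⟩ := hu.exists_circlePoint_le_mul hθ
  have hh := hu.isHalfDiskHarmonic
  have hlim := tendsto_integral_halfDiskKernel ⟨ht0, htp⟩ le_rfl Real.pi_pos.le le_rfl
    hh.continuousOn_circlePoint hC
  refine ⟨_, (hlim.const_mul (2 * π)⁻¹).congr' ?_⟩
  have hlt : ∀ᶠ r : ℝ in 𝓝[<] 1, 0 < r ∧ r < 1 := Ioo_mem_nhdsLT (by norm_num : (0 : ℝ) < 1)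
  filter_upwards [hlt] with r hr
  rw [hh.integral_halfDiskKernel (by rw [norm_mul_circlePoint hr.1.le]; exact hr.2)
    (by rw [im_mul_circlePoint]; exact (mul_pos hr.1 (sin_tangentAngle_pos ha)).le), tangentPoint]
  have := Real.pi_pos
  field_simp

/-- The normal at `T` is radial, so the limits along the radius of the big half disk are the normal
derivatives up to sign. The linear lower bound for `u - u'` with `m = 0` separates them strictly. -/
theorem normalDeriv_sq_lt_tangentPoint (hu : IsBumpSolution a δ φ θ u)
    (hu' : IsBumpSolution a δ φ θ' u') (hθ : θ < θ') (h : tangentAngle a < θ) :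
    ∃ d d' : ℝ, HasOutwardNormalDeriv u (tangentPoint a) (tangentPoint a) d ∧
      HasOutwardNormalDeriv u' (tangentPoint a) (tangentPoint a) d' ∧ d' ^ 2 < d ^ 2 := by
  have ha := hu.one_lt
  have ht0 := (tangentAngle_mem ha).1
  have htp := tangentAngle_lt_pi ha
  obtain ⟨L, hL⟩ := hu.tendsto_div_tangentPoint h
  obtain ⟨L', hL'⟩ := hu'.tendsto_div_tangentPoint (h.trans hθ)
  have hsub : Tendsto (fun y : ℝ => 1 - y) (𝓝[>] 0) (𝓝[<] 1) := by
    refine tendsto_nhdsWithin_iff.2 ⟨?_, ?_⟩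
    · have : ContinuousAt (fun y : ℝ => 1 - y) 0 := by fun_prop
      simpa using this.tendsto.mono_left nhdsWithin_le_nhds
    · filter_upwards [self_mem_nhdsWithin] with y hy
      exact sub_lt_self (1 : ℝ) hy
  have conv : ∀ {v : ℂ → ℝ} {L : ℝ},
      Tendsto (fun r : ℝ => v (r * tangentPoint a) / (1 - r)) (𝓝[<] 1) (𝓝 L) →
      Tendsto (fun y : ℝ => v (tangentPoint a - y * tangentPoint a) / y) (𝓝[>] 0) (𝓝 L) := by
    intro v L hv
    refine (hv.comp hsub).congr fun y => ?_
    simp only [Function.comp_apply, sub_sub_cancel, ofReal_sub, ofReal_one, sub_mul, one_mul]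
  have hlt : ∀ᶠ r : ℝ in 𝓝[<] 1, 0 < r ∧ r < 1 := Ioo_mem_nhdsLT (by norm_num : (0 : ℝ) < 1)
  refine exists_normalDeriv_sq_lt
    (hu.circlePoint_eq_zero ⟨le_rfl, htp.le⟩ fun h => not_lt.2 hu.tangentAngle_le h.1)
    (hu'.circlePoint_eq_zero ⟨le_rfl, htp.le⟩ fun h => not_lt.2 hu'.tangentAngle_le h.1)
    (conv hL) (conv hL') ?_ ?_
  · refine ge_of_tendsto hL' ?_
    filter_upwards [hlt] with r hr
    refine div_nonneg (hu'.nonneg (upperHalfDisk_subset_domain a ⟨?_, ?_⟩)) (by linarith [hr.2])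
    · rw [tangentPoint, norm_mul_circlePoint hr.1.le]; exact hr.2.le
    · rw [tangentPoint, im_mul_circlePoint]
      exact (mul_pos hr.1 (sin_tangentAngle_pos ha)).le
  · obtain ⟨c, hc, hev⟩ := hu.exists_mul_le_sub hu' hθ ht0 le_rfl h le_rfl
      fun t ht => hu.sub_nonneg_on_arc hu' hθ ht
    have : c ≤ L - L' := by
      refine ge_of_tendsto (hL.sub hL') ?_
      filter_upwards [hlt, hev] with r hr hre
      rw [← sub_div, le_div_iff₀ (by linarith [hr.2])]
      simpa [tangentPoint] using hre
    linarith

/-- A solution restricted to a half disk centered on the open segment between `a` and the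
tangency point. -/
theorem isHalfDiskHarmonic_comp (hu : IsBumpSolution a δ φ θ u) {x : ℂ} {ρ : ℝ} (hρ : 0 < ρ)
    (hx : x.re * Real.cos (tangentAngle a) + x.im * Real.sin (tangentAngle a) = 1)
    (hball : ∀ z, ‖z - x‖ ≤ ρ → 0 < z.im ∧ Real.cos (tangentAngle a) < z.re ∧ 1 < ‖z‖) :
    IsHalfDiskHarmonic (fun ζ => u (x + ρ * I * tangentPoint a * ζ)) ∧
      ∀ ζ : ℂ, ‖ζ‖ ≤ 1 → 0 < ζ.im →
        x + ρ * I * tangentPoint a * ζ ∈ interior (domain a) ∧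
          1 < ‖x + ρ * I * tangentPoint a * ζ‖ := by
  have ha := hu.one_lt
  have hb : ∀ ζ : ℂ, ‖ζ‖ ≤ 1 → ‖x + ρ * I * tangentPoint a * ζ - x‖ ≤ ρ := by
    intro ζ hζ
    rw [add_sub_cancel_left, norm_mul, norm_mul, norm_mul, tangentPoint, norm_circlePoint,
      Complex.norm_I, Complex.norm_real, Real.norm_of_nonneg hρ.le]
    nlinarith
  -- The affine map sends the direction `i` to `-T`, so height `ζ.im` becomes distance `ρ * ζ.im`
  -- from the tangent line, on the inner side.
  have hL : ∀ ζ : ℂ, (x + ρ * I * tangentPoint a * ζ).re * Real.cos (tangentAngle a) +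
      (x + ρ * I * tangentPoint a * ζ).im * Real.sin (tangentAngle a) = 1 - ρ * ζ.im := by
    intro ζ
    simp only [tangentPoint, add_re, add_im, mul_re, mul_im, ofReal_re, ofReal_im, I_re, I_im,
      circlePoint_re, circlePoint_im]
    linear_combination hx - ρ * ζ.im * Real.sin_sq_add_cos_sq (tangentAngle a)
  have hint : ∀ ζ : ℂ, ‖ζ‖ ≤ 1 → 0 < ζ.im →
      x + ρ * I * tangentPoint a * ζ ∈ interior (domain a) := by
    intro ζ hζ hζ'
    obtain ⟨h1, h2, -⟩ := hball _ (hb ζ hζ)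
    refine mem_interior_domain_of_triangle ha h1 h2 ?_
    rw [hL]
    have := mul_pos hρ hζ'
    linarith
  have hdom : ∀ ζ : ℂ, ‖ζ‖ ≤ 1 → 0 ≤ ζ.im → x + ρ * I * tangentPoint a * ζ ∈ domain a := by
    intro ζ hζ hζ'
    obtain ⟨h1, h2, -⟩ := hball _ (hb ζ hζ)
    refine mem_domain_of_triangle ha h1.le h2.le ?_
    rw [hL]
    have := mul_nonneg hρ.le hζ'
    linarith
  refine ⟨⟨?_, ?_, ?_⟩, fun ζ hζ hζ' => ⟨hint ζ hζ hζ', (hball _ (hb ζ hζ)).2.2⟩⟩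
  · exact hu.continuousOn.comp (by fun_prop) fun ζ hζ => hdom ζ hζ.1 hζ.2
  · exact fun ζ hζ => harmonicAt_comp_analyticAt (g := fun ζ => x + ρ * I * tangentPoint a * ζ)
      (hu.harmonic _ (hint ζ hζ.1.le hζ.2)) (by fun_prop)
  · intro ζ hζ hζ'
    refine hu.eq_zero_of_le_re (hdom ζ hζ hζ'.ge) (fun h => ?_) (hball _ (hb ζ hζ)).2.1.le
    have := support_lt ha h ⟨le_rfl, (tangentAngle_lt_pi ha).le⟩
    rw [hL, hζ', mul_zero, sub_zero] at this
    exact lt_irrefl _ this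

/-- In a half disk centred at `x` that stays outside the unit disk, the inward derivatives are
integrals over the half circle with weight a multiple of `sin t`; the strict inequality in the cap
passes to them. -/
theorem normalDeriv_sq_lt_segment (hu : IsBumpSolution a δ φ θ u)
    (hu' : IsBumpSolution a δ φ θ' u') (hθ : θ < θ') {x : ℂ}
    (hx : x ∈ segment ℝ (a : ℂ) (tangentPoint a)) (hxa : x ≠ (a : ℂ)) (hxT : x ≠ tangentPoint a) :
    ∃ d d' : ℝ, HasOutwardNormalDeriv u (tangentPoint a) x d ∧
      HasOutwardNormalDeriv u' (tangentPoint a) x d' ∧ d' ^ 2 < d ^ 2 := by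
  have ha := hu.one_lt
  have hc := cos_tangentAngle_pos ha
  have hs := sin_tangentAngle_pos ha
  have hac := mul_cos_tangentAngle ha
  have hsq := Real.sin_sq_add_cos_sq (tangentAngle a)
  rw [segment_eq_image] at hx
  obtain ⟨l, hl, rfl⟩ := hx
  have hl0 : 0 < l := hl.1.lt_of_ne (by rintro rfl; simp at hxa)
  have hl1 : l < 1 := hl.2.lt_of_ne (by rintro rfl; simp at hxT)
  set x : ℂ := (1 - l) • (a : ℂ) + l • tangentPoint a with hxdef
  have hre : x.re = (1 - l) * a + l * Real.cos (tangentAngle a) := by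
    simp [hxdef, tangentPoint, circlePoint_re]
  have him : x.im = l * Real.sin (tangentAngle a) := by
    simp [hxdef, tangentPoint, circlePoint_im]
  have hL : x.re * Real.cos (tangentAngle a) + x.im * Real.sin (tangentAngle a) = 1 := by
    rw [hre, him]
    linear_combination (1 - l) * hac + l * hsq
  have hca : Real.cos (tangentAngle a) < a := (Real.cos_le_one _).trans_lt ha
  have hn : 1 < ‖x‖ := by
    have h1 : x.re * Real.sin (tangentAngle a) - x.im * Real.cos (tangentAngle a) =
        (1 - l) * a * Real.sin (tangentAngle a) := by rw [hre, him]; ring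
    have h2 : 0 < (1 - l) * a * Real.sin (tangentAngle a) :=
      mul_pos (mul_pos (by linarith) (by linarith)) hs
    have h3 := re_sq_add_im_sq x
    have h4 : x.re ^ 2 + x.im ^ 2 =
        (x.re * Real.cos (tangentAngle a) + x.im * Real.sin (tangentAngle a)) ^ 2 +
        (x.re * Real.sin (tangentAngle a) - x.im * Real.cos (tangentAngle a)) ^ 2 := by
      linear_combination -(x.re ^ 2 + x.im ^ 2) * hsq
    rw [hL, h1] at h4
    nlinarith [norm_nonneg x, pow_pos h2 2]
  have hopen : ∀ᶠ z in 𝓝 x, 0 < z.im ∧ Real.cos (tangentAngle a) < z.re ∧ 1 < ‖z‖ := by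
    refine (continuous_im.continuousAt.eventually_const_lt ?_).and
      ((continuous_re.continuousAt.eventually_const_lt ?_).and
        (continuous_norm.continuousAt.eventually_const_lt hn))
    · rw [him]; positivity
    · rw [hre]; nlinarith
  obtain ⟨ε, hε, hball⟩ := Metric.eventually_nhds_iff_ball.1 hopen
  obtain ⟨ρ, hρ, hρε⟩ := exists_between hε
  have hball' : ∀ z, ‖z - x‖ ≤ ρ → 0 < z.im ∧ Real.cos (tangentAngle a) < z.re ∧ 1 < ‖z‖ :=
    fun z hz => hball z (by rw [mem_ball, dist_eq_norm]; linarith)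
  obtain ⟨hg, hint⟩ := hu.isHalfDiskHarmonic_comp hρ hL hball'
  obtain ⟨hg', -⟩ := hu'.isHalfDiskHarmonic_comp hρ hL hball'
  have hx0 : u x = 0 := by simpa using hg.eq_zero 0 (by simp) (by simp)
  have hx0' : u' x = 0 := by simpa using hg'.eq_zero 0 (by simp) (by simp)
  have hscale : Tendsto (fun y : ℝ => y / ρ) (𝓝[>] 0) (𝓝[>] 0) := by
    refine tendsto_nhdsWithin_iff.2 ⟨?_, ?_⟩
    · have : ContinuousAt (fun y : ℝ => y / ρ) 0 := by fun_prop
      simpa using this.tendsto.mono_left nhdsWithin_le_nhds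
    · filter_upwards [self_mem_nhdsWithin] with y hy
      exact div_pos hy hρ
  have hρ' : (ρ : ℂ) ≠ 0 := by exact_mod_cast hρ.ne'
  have conv : ∀ {v : ℂ → ℝ} {L : ℝ},
      Tendsto (fun y : ℝ => v (x + ρ * I * tangentPoint a * (y * I)) / y) (𝓝[>] 0) (𝓝 L) →
      Tendsto (fun y : ℝ => v (x - y * tangentPoint a) / y) (𝓝[>] 0) (𝓝 (L / ρ)) := by
    intro v L hv
    refine ((hv.comp hscale).div_const ρ).congr fun y => ?_
    have e : x + ρ * I * tangentPoint a * ((y / ρ : ℝ) * I) = x - y * tangentPoint a := by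
      push_cast
      field_simp
      linear_combination (tangentPoint a * y) * Complex.I_sq
    simp only [Function.comp_apply, e]
    rw [div_div, div_mul_cancel₀ _ hρ.ne']
  have hT := hg.tendsto_div_center
  have hT' := hg'.tendsto_div_center
  refine exists_normalDeriv_sq_lt hx0 hx0' (conv hT) (conv hT') ?_ ?_
  · have hpi := Real.pi_pos
    refine div_nonneg (ge_of_tendsto hT' ?_) hρ.le
    have hlt : ∀ᶠ y : ℝ in 𝓝[>] 0, 0 < y ∧ y < 1 := Ioo_mem_nhdsGT (by norm_num : (0 : ℝ) < 1)
    filter_upwards [hlt] with y hy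
    refine div_nonneg (hu'.nonneg (interior_subset (hint (y * I) ?_ ?_).1)) hy.1.le
    · simp [abs_of_pos hy.1, hy.2.le]
    · simpa using hy.1
  · refine div_lt_div_of_pos_right ?_ hρ
    have hpi := Real.pi_pos
    refine mul_lt_mul_of_pos_left ?_ (by positivity)
    have hi : ∀ {g : ℂ → ℝ}, IsHalfDiskHarmonic g → IntervalIntegrable
        (fun t => 4 * Real.sin t * g (circlePoint t)) volume 0 π := fun hg =>
      ((continuous_const.mul Real.continuous_sin).continuousOn.mul
        hg.continuousOn_circlePoint).intervalIntegrable_of_Icc hpi.le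
    rw [← sub_pos, ← intervalIntegral.integral_sub (hi hg) (hi hg')]
    refine intervalIntegral.intervalIntegral_pos_of_pos_on ((hi hg).sub (hi hg')) (fun t ht => ?_)
      hpi
    have hst := Real.sin_pos_of_mem_Ioo ht
    obtain ⟨h1, h2⟩ := hint (circlePoint t) (norm_circlePoint t).le (by rwa [circlePoint_im])
    rw [← mul_sub]
    exact mul_pos (by positivity) (sub_pos.2 (hu.lt_of_one_lt_norm hu' hθ h1 h2))

end IsBumpSolution

end HalfCap

end

theorem mainTheorem6 (a : ℝ) (ha : 1 < a) (δ : ℝ) (hδ : 0 < δ) (φ : ℝ → ℝ)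
    (hφ0 : φ 0 = 0) (hφδ : φ δ = 0) (hφpos : ∀ t ∈ Set.Ioo 0 δ, 0 < φ t)
    (θ θ' : ℝ) (hθ : HalfCap.tangentAngle a ≤ θ) (hθθ' : θ < θ') (hθ' : θ' ≤ Real.pi - δ)
    (u u' : ℂ → ℝ) (hu : HalfCap.IsSolution a δ φ θ u) (hu' : HalfCap.IsSolution a δ φ θ' u') :
    (∀ z ∈ interior (HalfCap.halfCap a), u' z < u z) ∧
    (∀ x ∈ segment ℝ (a : ℂ) (HalfCap.tangentPoint a), x ≠ (a : ℂ) →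
      (x = HalfCap.tangentPoint a → HalfCap.tangentAngle a < θ) →
      ∃ d d' : ℝ,
        HalfCap.HasOutwardNormalDeriv u (HalfCap.tangentPoint a) x d ∧
        HalfCap.HasOutwardNormalDeriv u' (HalfCap.tangentPoint a) x d' ∧
        d' ^ 2 < d ^ 2) := by
  have hb : HalfCap.IsBumpSolution a δ φ θ u :=
    ⟨hu, ha, hδ, hφ0, hφδ, hφpos, hθ, by linarith⟩
  have hb' : HalfCap.IsBumpSolution a δ φ θ' u' :=
    ⟨hu', ha, hδ, hφ0, hφδ, hφpos, by linarith, by linarith⟩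
  refine ⟨fun z hz => ?_, fun x hx hxa hxT => ?_⟩
  · obtain ⟨h1, h2, -⟩ := HalfCap.mem_interior_domain_of_mem_interior_halfCap ha hz
    exact hb.lt_of_one_lt_norm hb' hθθ' h1 h2
  · by_cases h : x = HalfCap.tangentPoint a
    · rw [h]
      exact hb.normalDeriv_sq_lt_tangentPoint hb' hθθ' (hxT h)
    · exact hb.normalDeriv_sq_lt_segment hb' hθθ' hx hxa h
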